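/- Definitions. Let $S\subset\mathbb{R}^2$ be a finite set of points (sites), each $s\in S$ with an appetite $A(s)>0$. A stable-matching Voronoi diagram of $(S,A)$ is a cover of $\mathbb{R}^2$ by closed sets $C_s$ ($s\in S$) and $C_\emptyset$ such that distinct regions meet only in common boundary points, $C_s$ has area $A(s)$ for each $s\in S$, and there is no blocking pair, i.e. no $s\in S$ and $p\in\mathbb{R}^2$ with $p\notin C_s$, $d(p,s)<\max_{p'\in C_s}d(p',s)$, and either $p\in C_\emptyset$ or $p\in C_{s'}$ for some site $s'$ with $d(p,s)<d(p,s')$. The bounding disk of $s$ is the smallest closed disk centered at $s$ that contains $C_s$. Faces are the connected components of the regions; a curved edge is a maximal circular arc on the common boundary of two faces; $(S,A)$ is in general position if no two different curved edges of its diagram touch at a point that is not an endpoint of either. The algebraic model of computation is a random access machine on real numbers with sign tests, indirect addressing by integer registers, constants that are real algebraic numbers, and the exact operations $+,-,\times,\div$ and the computation of any real root of a polynomial whose coefficients have been computed; the input consists of the coordinates and the appetites of the sites, and a number is computable from the input if some program halts with exactly this number as output. Statement. There are infinitely many finite sets $S$ of sites with algebraic coordinates which, with all appetites equal to $1$, are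 in general position and have a stable-matching Voronoi diagram in which the radius of the bounding disk of some site cannot be computed in the algebraic model from $S$ and the appetites. Specifically, let $x,y,b$ be real algebraic numbers with $0<b<\sqrt{1/\pi}$ and let $S=\{(x-b,y),(x+b,y)\}$, two sites at distance $2b$, both with appetite $1$. Then $S$ is in general position and has a stable-matching Voronoi diagram; in every such diagram both bounding disks have the same radius $r$, where $r>b$ is the unique solution in $[b,\infty)$ of \[ r^2\left(\pi-\arccos\frac{b}{r}\right)+b\sqrt{r^2-b^2}=1 , \] and $r$ cannot be computed in the algebraic model from $S$ and the appetites. -/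

import Mathlib

open MeasureTheory

noncomputable section

/-- The Euclidean plane, with the Euclidean distance and Lebesgue measure (area) as `volume`. -/
abbrev Plane := EuclideanSpace ℝ (Fin 2)

/-! ### Stable-matching Voronoi diagrams -/

/-- A family of regions of the plane: `region (some s)` is the region `C_s` of the site `s`, and
`region none` is the region `C_∅` of the unmatched points. -/
structure Diagram (S : Finset Plane) where
  region : Option S → Set Plane

namespace Diagram

variable {S : Finset Plane}

/-- `s` and `p` form a blocking pair: `p` is not in the region of `s`, `s` prefers `p` to some
point of its region (that is, `p` is closer to `s` than the farthest point of the region), and `p`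
is unmatched or prefers `s` to a site to whose region it belongs. -/
def IsBlockingPair (D : Diagram S) (s : S) (p : Plane) : Prop :=
  p ∉ D.region (some s) ∧
  (∃ p' ∈ D.region (some s), dist p s < dist p' s) ∧
  (p ∈ D.region none ∨ ∃ s' : S, p ∈ D.region (some s') ∧ dist p s < dist p s')

/-- `D` is a stable-matching Voronoi diagram of the sites `S` with appetites `A`. -/
structure IsStableMatching (D : Diagram S) (A : S → ℝ) : Prop where
  isClosed_region : ∀ i, IsClosed (D.region i)
  iUnion_region : ⋃ i, D.region i = Set.univ
  /-- Distinct regions meet only in common boundary points. -/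
  inter_subset : ∀ i j, i ≠ j →
    D.region i ∩ D.region j ⊆ frontier (D.region i) ∩ frontier (D.region j)
  area_region : ∀ s, volume (D.region (some s)) = ENNReal.ofReal (A s)
  stable : ∀ s p, ¬ D.IsBlockingPair s p

/-- `r` is the radius of the bounding disk of `s`, the smallest closed disk centered at `s` that
contains the region of `s`. -/
def IsBoundingRadius (D : Diagram S) (s : S) (r : ℝ) : Prop :=
  IsLeast {ρ : ℝ | 0 ≤ ρ ∧ D.region (some s) ⊆ Metric.closedBall (s : Plane) ρ} r

/-- A face is a maximal connected subset of a region (possibly of the unmatched region). -/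
def IsFace (D : Diagram S) (F : Set Plane) : Prop :=
  ∃ i, ∃ x ∈ D.region i, F = connectedComponentIn (D.region i) x

end Diagram

/-- A circular arc of positive length, possibly a full circle. -/
structure CircularArc where
  center : Plane
  radius : ℝ
  radius_pos : 0 < radius
  start : ℝ
  extent : ℝ
  extent_pos : 0 < extent
  extent_le : extent ≤ 2 * Real.pi

namespace CircularArc

/-- The point of the circle of the arc at angle `θ`. -/
def point (γ : CircularArc) (θ : ℝ) : Plane :=
  γ.center + γ.radius • !₂[Real.cos θ, Real.sin θ]

/-- The points of the arc. -/
def carrier (γ : CircularArc) : Set Plane :=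
  γ.point '' Set.Icc γ.start (γ.start + γ.extent)

/-- `p` is an endpoint of the arc; a full circle has no endpoints. -/
def IsEndpoint (γ : CircularArc) (p : Plane) : Prop :=
  γ.extent < 2 * Real.pi ∧ (p = γ.point γ.start ∨ p = γ.point (γ.start + γ.extent))

end CircularArc

namespace Diagram

variable {S : Finset Plane}

/-- A curved edge is a maximal circular arc on the common boundary of two faces. -/
def IsCurvedEdge (D : Diagram S) (γ : CircularArc) : Prop :=
  ∃ F F', D.IsFace F ∧ D.IsFace F' ∧ F ≠ F' ∧
    γ.carrier ⊆ frontier F ∩ frontier F' ∧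
    ∀ γ' : CircularArc, γ'.carrier ⊆ frontier F ∩ frontier F' →
      γ.carrier ⊆ γ'.carrier → γ'.carrier = γ.carrier

/-- Two different curved edges touch at a point that is not an endpoint. -/
def HasTangentEdges (D : Diagram S) : Prop :=
  ∃ γ γ' : CircularArc, D.IsCurvedEdge γ ∧ D.IsCurvedEdge γ' ∧ γ.carrier ≠ γ'.carrier ∧
    ∃ p ∈ γ.carrier ∩ γ'.carrier, ¬ γ.IsEndpoint p ∧ ¬ γ'.IsEndpoint p

end Diagram

/-- The sites with their appetites are in general position: no two curved edges of the
stable-matching Voronoi diagram are tangent. -/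
def InGeneralPosition (S : Finset Plane) (A : S → ℝ) : Prop :=
  ∀ D : Diagram S, D.IsStableMatching A → ¬ D.HasTangentEdges

/-- The point has algebraic coordinates. -/
def HasAlgebraicCoordinates (s : Plane) : Prop :=
  ∀ k : Fin 2, IsAlgebraic ℚ (s k)

/-! ### An algebraic random access machine over the reals

The machine has real cells `mem` and natural-number cells `idx`, the latter for addressing and
counting. On real numbers it has algebraic constants, the four arithmetic operations, exact real
root finding for polynomials (in particular, extraction of roots of any order) and sign tests. -/

inductive ArithOp
  | add
  | sub
  | mul
  | div

def ArithOp.eval : ArithOp → ℝ → ℝ → ℝ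
  | .add, x, y => x + y
  | .sub, x, y => x - y
  | .mul, x, y => x * y
  | .div, x, y => x / y

inductive Instr
  /-- `mem i := c` -/
  | const (i : ℕ) (c : ℝ) (hc : IsAlgebraic ℚ c)
  /-- `mem i := mem j ∘ mem k` -/
  | arith (op : ArithOp) (i j k : ℕ)
  /-- `mem i :=` the real root number `idx m` (counted in increasing order from 0) of the
  polynomial of formal degree `idx d` whose coefficients, from the constant one on, are in
  consecutive cells starting at `mem (idx a)` -/
  | solve (i a d m : ℕ)
  /-- `mem i := mem (idx a)` -/
  | load (i a : ℕ)
  /-- `mem (idx a) := mem i` -/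
  | store (a i : ℕ)
  /-- `idx a := n` -/
  | idxConst (a n : ℕ)
  /-- `idx a := idx b + idx c` -/
  | idxAdd (a b c : ℕ)
  /-- `idx a := idx b - idx c` (truncated) -/
  | idxSub (a b c : ℕ)
  /-- go to instruction `t` if `mem i` is positive -/
  | jumpPos (i t : ℕ)
  /-- go to instruction `t` if `idx a` is zero -/
  | jumpIdxZero (a t : ℕ)

structure MachineState where
  pc : ℕ
  idx : ℕ → ℕ
  mem : ℕ → ℝ

/-- The real root number `m`, in increasing order from 0, of the polynomial with coefficients
`c 0, …, c d`; the value is 0 if there is no such root or if the polynomial is zero. -/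
def realRoot (c : ℕ → ℝ) (d m : ℕ) : ℝ :=
  ((∑ k ∈ Finset.range (d + 1), Polynomial.monomial k (c k)).roots.toFinset.sort (· ≤ ·)).getD m 0

def Instr.exec (σ : MachineState) : Instr → MachineState
  | .const i c _ => ⟨σ.pc + 1, σ.idx, Function.update σ.mem i c⟩
  | .arith op i j k =>
      ⟨σ.pc + 1, σ.idx, Function.update σ.mem i (op.eval (σ.mem j) (σ.mem k))⟩
  | .solve i a d m =>
      ⟨σ.pc + 1, σ.idx, Function.update σ.mem i
        (realRoot (fun k => σ.mem (σ.idx a + k)) (σ.idx d) (σ.idx m))⟩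
  | .load i a => ⟨σ.pc + 1, σ.idx, Function.update σ.mem i (σ.mem (σ.idx a))⟩
  | .store a i => ⟨σ.pc + 1, σ.idx, Function.update σ.mem (σ.idx a) (σ.mem i)⟩
  | .idxConst a n => ⟨σ.pc + 1, Function.update σ.idx a n, σ.mem⟩
  | .idxAdd a b c => ⟨σ.pc + 1, Function.update σ.idx a (σ.idx b + σ.idx c), σ.mem⟩
  | .idxSub a b c => ⟨σ.pc + 1, Function.update σ.idx a (σ.idx b - σ.idx c), σ.mem⟩
  | .jumpPos i t => ⟨if 0 < σ.mem i then t else σ.pc + 1, σ.idx, σ.mem⟩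
  | .jumpIdxZero a t => ⟨if σ.idx a = 0 then t else σ.pc + 1, σ.idx, σ.mem⟩

/-- A program is a finite list of instructions. -/
abbrev Program := List Instr

/-- One step; the machine halts, and stays put, when no instruction has number `pc`. -/
def Program.step (P : Program) (σ : MachineState) : MachineState :=
  match P[σ.pc]? with
  | none => σ
  | some ins => ins.exec σ

/-- Started in state `σ`, the program halts after finitely many steps with `r` in real cell 0. -/
def Program.Outputs (P : Program) (σ : MachineState) (r : ℝ) : Prop :=
  ∃ t : ℕ, P[(P.step^[t] σ).pc]? = none ∧ (P.step^[t] σ).mem 0 = r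

/-- The initial state for a list of sites with appetites: the number of sites is in `idx 0`, and
the coordinates and the appetites of the sites are in the first real cells. -/
def initialState {S : Finset Plane} (A : S → ℝ) (l : List S) : MachineState where
  pc := 0
  idx := fun a => if a = 0 then l.length else 0
  mem := fun k => (l.flatMap fun s : S => [(s : Plane) 0, (s : Plane) 1, A s]).getD k 0

/-- Some program of the algebraic machine, given the sites of `S` (listed in some order) and their
appetites as input, halts with output exactly `r`. -/
def AlgebraicallyComputable (S : Finset Plane) (A : S → ℝ) (r : ℝ) : Prop :=
  ∃ P : Program, ∃ l : List S, l.Nodup ∧ (∀ s, s ∈ l) ∧ P.Outputs (initialState A l) r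

/-! ### The example -/

open Classical in
/-- Two sites, aligned horizontally at distance `2 * b`, with midpoint `(x, y)`. -/
def twoSites (x y b : ℝ) : Finset Plane := {!₂[x - b, y], !₂[x + b, y]}

end

/-! ### The Hermite–Lindemann theorem -/

noncomputable section

namespace HermiteLindemann

open Polynomial

/-! In a stable diagram of the two sites both regions reach equally far, to some `r`, and each is
squeezed between the open and the closed disk of radius `r` about its site, cut along the
perpendicular bisector. The cut disk is a circular sector of half-angle `θ = π - arccos (b / r)`
together with a triangle of height `b`, so unit area is exactly the equation for `r`. If `r` were
algebraic, the equation would make `θ` algebraic; but `cos θ = -b / r`, so `exp (iθ)` would be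
algebraic with a nonzero algebraic exponent, against Hermite–Lindemann. A machine started on
algebraic numbers only ever stores algebraic numbers, hence never outputs `r`.

Hermite–Lindemann is reduced, by a norm over the Galois group, to `add_sum_exp_ne_zero`, where
simultaneous approximation of exponentials produces an integer that is both zero and nonzero modulo
a large prime. On the geometric side, `openHalfDisk_subset` is what stability gives,
`not_maxDist_lt` makes the radii equal, and `volume_openHalfDisk_of_sites` computes the area.
General position holds because a curved edge can only be one of two circular arcs
(`center_eq_and_carrier_eq_arcSet`), which meet only on the bisector, where they end. -/

theorem exists_prime_mul_pow_div_factorial_lt (C a : ℝ) (N : ℕ) :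
    ∃ p : ℕ, p.Prime ∧ N < p ∧ C * (a ^ p / (p - 1).factorial) < 1 := by
  have h := ((FloorSemiring.tendsto_pow_div_factorial_atTop a).const_mul (C * a)).eventually
    (gt_mem_nhds (show C * a * 0 < (1 : ℝ) by simp))
  obtain ⟨M, hM⟩ := Filter.eventually_atTop.1 h
  obtain ⟨p, hp, hpp⟩ := Nat.exists_infinite_primes (max M N + 1)
  refine ⟨p, hpp, by omega, ?_⟩
  have := hM (p - 1) (by omega)
  have hpow : a ^ p = a * a ^ (p - 1) := by
    rw [← pow_succ', Nat.sub_add_cancel hpp.one_le]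
  rw [hpow]
  calc _ = C * a * (a ^ (p - 1) / (p - 1).factorial) := by ring
    _ < 1 := this

variable {K : Type*} [Field K]

/-- The monomial of degree `i` absorbs `i` of the `N` factors `m`; the others remain as an integer
coefficient. -/
theorem isIntegral_pow_mul_aeval {m : ℤ} {x : K} (hx : IsIntegral ℤ (m • x)) (g : ℤ[X]) {N : ℕ}
    (hN : g.natDegree ≤ N) : IsIntegral ℤ ((m : K) ^ N * aeval x g) := by
  rw [aeval_eq_sum_range' (Nat.lt_succ_of_le hN), Finset.mul_sum]
  refine IsIntegral.sum _ fun i hi => ?_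
  have hi' : i ≤ N := Nat.lt_succ_iff.1 (Finset.mem_range.1 hi)
  have : (m : K) ^ N * (g.coeff i • x ^ i)
      = ((g.coeff i * m ^ (N - i) : ℤ) : K) * (m • x) ^ i := by
    rw [zsmul_eq_mul, zsmul_eq_mul, ← Nat.sub_add_cancel hi', pow_add]
    simp only [Nat.add_sub_cancel]
    push_cast
    ring
  rw [this]
  exact (isIntegral_algebraMap (R := ℤ) (A := K)).mul (hx.pow i)

/-- Fixed by the Galois group means rational, and a rational algebraic integer is an integer. -/
theorem exists_int_eq_of_fixed [Algebra ℚ K] [FiniteDimensional ℚ K] [IsGalois ℚ K] {x : K}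
    (hx : IsIntegral ℤ x) (hfix : ∀ σ : K ≃ₐ[ℚ] K, σ x = x) : ∃ k : ℤ, x = k := by
  obtain ⟨q, hq⟩ := IntermediateField.mem_bot.1 ((IsGalois.mem_bot_iff_fixed x).2 hfix)
  rw [← hq, isIntegral_algebraMap_iff (algebraMap ℚ K).injective] at hx
  obtain ⟨k, hk⟩ := IsIntegrallyClosed.algebraMap_eq_of_integral hx
  exact ⟨k, by rw [← hq, ← hk]; simp⟩

/-- This supplies the polynomial whose roots include all exponents, as the approximation of
exponentials requires. A nonzero constant term can be had because no exponent is zero. -/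
theorem exists_int_polynomial_of_ne_zero [Algebra ℚ K] [FiniteDimensional ℚ K] (φ : K →+* ℂ)
    (T : Finset K) (h0 : 0 ∉ T) :
    ∃ f : ℤ[X], f.eval 0 ≠ 0 ∧ ∀ γ ∈ T, aeval (φ γ) f = 0 := by
  have key : ∀ γ ∈ T, ∃ f : ℤ[X], f.eval 0 ≠ 0 ∧ aeval (φ γ) f = 0 := by
    intro γ hγ
    have hγ0 : γ ≠ 0 := fun h => h0 (h ▸ hγ)
    have halg : IsAlgebraic ℤ γ :=
      (IsFractionRing.isAlgebraic_iff ℤ ℚ K).2 (Algebra.IsAlgebraic.isAlgebraic γ)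
    obtain ⟨q, hq0, hq⟩ := halg.exists_nonzero_coeff_and_aeval_eq_zero
      (mem_nonZeroDivisors_of_ne_zero hγ0)
    refine ⟨q, by rwa [← coeff_zero_eq_eval_zero], ?_⟩
    have := congrArg φ.toIntAlgHom hq
    rw [← aeval_algHom_apply] at this
    simpa using this
  choose! f hf0 hf using key
  refine ⟨∏ γ ∈ T, f γ, ?_, fun γ hγ => ?_⟩
  · rw [eval_prod]
    exact Finset.prod_ne_zero_iff.2 hf0
  · rw [map_prod]
    exact Finset.prod_eq_zero hγ (hf γ hγ)

/-- A Galois-equivariant combination of exponentials with nonzero constant term does not vanish. -/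
theorem add_sum_exp_ne_zero [Algebra ℚ K] [FiniteDimensional ℚ K] [IsGalois ℚ K] (φ : K →+* ℂ)
    (T : Finset K) (h0 : 0 ∉ T) (hT : ∀ σ : K ≃ₐ[ℚ] K, ∀ γ ∈ T, σ γ ∈ T) (v : K → K)
    (hv : ∀ (σ : K ≃ₐ[ℚ] K) γ, v (σ γ) = σ (v γ)) (hv0 : v 0 ≠ 0) :
    φ (v 0) + ∑ γ ∈ T, φ (v γ) * Complex.exp (φ γ) ≠ 0 := by
  classical
  intro hsum
  have : CharZero K := algebraRat.charZero K
  obtain ⟨m, hm0, hm⟩ := exists_integral_multiples ℤ ℚ (insert (v 0) (T ∪ T.image v))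
  obtain ⟨f, hf0, hf⟩ := exists_int_polynomial_of_ne_zero φ T h0
  -- For every large prime `p`, an integer `n` prime to `p` and an integer polynomial `g` make `n *
  -- exp γ - p * g γ` at most `c ^ p / (p - 1)!` at every root `γ` of `f`.
  obtain ⟨c, hc⟩ := LindemannWeierstrass.exp_polynomial_approx f hf0
  set D := f.natDegree
  obtain ⟨k, hk⟩ := exists_int_eq_of_fixed (hm (v 0) (by simp)) fun σ => by
    rw [map_zsmul, ← hv σ 0, map_zero]
  have hk0 : k ≠ 0 := by
    rintro rfl
    rw [zsmul_eq_mul] at hk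
    simp [hm0, hv0] at hk
  -- The prime exceeds `|f 0|` for the approximation to apply, and `|m|` and `|k|` so that it
  -- divides neither; the last bound beats the total error.
  obtain ⟨p, hp, hNp, hlt⟩ := exists_prime_mul_pow_div_factorial_lt
    (∑ γ ∈ T, ‖φ (m • v γ)‖) (|(m : ℝ)| ^ D * |c|)
    (max (f.eval 0).natAbs (max m.natAbs k.natAbs))
  obtain ⟨n, hpn, g, hg, happ⟩ := hc p (by omega) hp
  have hgD : g.natDegree ≤ p * D := hg.trans (Nat.sub_le _ _)
  -- the algebraic part is a rational integer
  obtain ⟨M, hM⟩ : ∃ M : ℤ, ∑ γ ∈ T, (m • v γ) * ((m : K) ^ (p * D) * aeval γ g) = M := by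
    apply exists_int_eq_of_fixed
    · refine IsIntegral.sum _ fun γ hγ => (hm _ ?_).mul (isIntegral_pow_mul_aeval (hm _ ?_) g hgD)
      · exact Finset.mem_insert_of_mem (Finset.mem_union_right _ (Finset.mem_image_of_mem v hγ))
      · exact Finset.mem_insert_of_mem (Finset.mem_union_left _ hγ)
    · intro σ
      rw [map_sum]
      refine Finset.sum_bij (fun γ _ => σ γ) (fun γ hγ => hT σ γ hγ)
        (fun a _ b _ h => σ.injective h) (fun b hb => ⟨σ.symm b, hT σ.symm b hb, by simp⟩) ?_
      intro γ _
      have h1 : σ (aeval γ g) = aeval (σ γ) g := by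
        have := aeval_algHom_apply (σ : K →ₐ[ℚ] K).toRingHom.toIntAlgHom γ g
        exact this.symm
      rw [hv, map_mul, map_mul, map_zsmul, map_pow, map_intCast, h1]
  have hMC : ∑ γ ∈ T, φ (m • v γ) * ((m : ℂ) ^ (p * D) * aeval (φ γ) g) = M := by
    have := congrArg φ hM
    rw [map_sum, map_intCast] at this
    rw [← this]
    refine Finset.sum_congr rfl fun γ _ => ?_
    have h1 : φ (aeval γ g) = aeval (φ γ) g :=
      (aeval_algHom_apply φ.toIntAlgHom γ g).symm
    rw [map_mul, map_mul, map_pow, map_intCast, h1]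
  have hkC : (m : ℂ) * φ (v 0) = k := by
    have := congrArg φ hk
    rwa [zsmul_eq_mul, map_mul, map_intCast, map_intCast] at this
  -- the integer is close to zero
  have hid : ((m ^ (p * D) * n * k + p * M : ℤ) : ℂ)
      = -∑ γ ∈ T, φ (m • v γ) * ((m : ℂ) ^ (p * D) *
          (n • Complex.exp (φ γ) - p • aeval (φ γ) g)) := by
    have e1 : ∑ γ ∈ T, φ (m • v γ) * ((m : ℂ) ^ (p * D) *
          (n • Complex.exp (φ γ) - p • aeval (φ γ) g))
        = (m : ℂ) ^ (p * D) * n * m * ∑ γ ∈ T, φ (v γ) * Complex.exp (φ γ)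
          - p * ∑ γ ∈ T, φ (m • v γ) * ((m : ℂ) ^ (p * D) * aeval (φ γ) g) := by
      rw [Finset.mul_sum, Finset.mul_sum, ← Finset.sum_sub_distrib]
      refine Finset.sum_congr rfl fun γ _ => ?_
      simp only [zsmul_eq_mul, nsmul_eq_mul, map_mul, map_intCast]
      ring
    rw [e1, hMC, eq_neg_of_add_eq_zero_right hsum]
    push_cast
    rw [← hkC]
    ring
  have hroot : ∀ γ ∈ T, φ γ ∈ f.aroots ℂ := fun γ hγ => by
    rw [mem_aroots]
    exact ⟨fun h => hf0 (by simp [h]), hf γ hγ⟩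
  have hsmall : ‖((m ^ (p * D) * n * k + p * M : ℤ) : ℂ)‖ < 1 := by
    rw [hid, norm_neg]
    refine lt_of_le_of_lt (norm_sum_le _ _) (lt_of_le_of_lt ?_ hlt)
    rw [Finset.sum_mul]
    refine Finset.sum_le_sum fun γ hγ => ?_
    rw [norm_mul]
    refine mul_le_mul_of_nonneg_left ?_ (norm_nonneg _)
    rw [norm_mul, norm_pow, Complex.norm_intCast, mul_pow, ← pow_mul, mul_comm D p, mul_div_assoc]
    refine mul_le_mul_of_nonneg_left ((happ (hroot γ hγ)).trans ?_) (by positivity)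
    exact div_le_div_of_nonneg_right ((le_abs_self _).trans_eq (abs_pow _ _)) (by positivity)
  have hzero : m ^ (p * D) * n * k + p * M = 0 := by
    rw [Complex.norm_intCast] at hsmall
    exact Int.abs_lt_one_iff.1 (by exact_mod_cast hsmall)
  -- The vanishing integer is `m ^ (p * D) * n * k` modulo `p`, a product of factors prime to `p`.
  have hdvd : (p : ℤ) ∣ m ^ (p * D) * n * k := by
    rw [eq_neg_of_add_eq_zero_left hzero, dvd_neg]
    exact dvd_mul_right _ _
  have hpZ : Prime (p : ℤ) := Nat.prime_iff_prime_int.1 hp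
  have hbig : ∀ {z : ℤ}, z ≠ 0 → z.natAbs < p → ¬ (p : ℤ) ∣ z := fun hz hlt hd =>
    absurd (Nat.le_of_dvd (Int.natAbs_pos.2 hz) (Int.natCast_dvd.1 hd)) (by omega)
  rcases hpZ.dvd_or_dvd hdvd with h | h
  · rcases hpZ.dvd_or_dvd h with h | h
    · exact hbig hm0 (by omega) (hpZ.dvd_of_dvd_pow h)
    · exact hpn h
  · exact hbig hk0 (by omega) h

/-- The Galois group acting on coefficients and exponents of the group algebra `K[K]`. -/
def twist [Algebra ℚ K] (σ : K ≃ₐ[ℚ] K) : AddMonoidAlgebra K K →+* AddMonoidAlgebra K K :=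
  (AddMonoidAlgebra.mapRingHom K (σ : K →+* K)).comp
    (AddMonoidAlgebra.mapDomainRingHom K (σ : K →+ K))

theorem twist_single [Algebra ℚ K] (σ : K ≃ₐ[ℚ] K) (γ c : K) :
    twist σ (.single γ c) = .single (σ γ) (σ c) := by
  simp [twist]

theorem twist_twist [Algebra ℚ K] (σ τ : K ≃ₐ[ℚ] K) (u : AddMonoidAlgebra K K) :
    twist σ (twist τ u) = twist (σ * τ) u := by
  induction u using AddMonoidAlgebra.induction_linear with
  | zero => simp
  | add x y hx hy => simp [hx, hy]
  | single m r => simp [twist_single]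

theorem coeff_twist [Algebra ℚ K] (σ : K ≃ₐ[ℚ] K) (u : AddMonoidAlgebra K K) (γ : K) :
    (twist σ u).coeff (σ γ) = σ (u.coeff γ) := by
  classical
  induction u using AddMonoidAlgebra.induction_linear with
  | zero => simp
  | add x y hx hy => simp [hx, hy]
  | single m r =>
    rw [twist_single]
    simp only [AddMonoidAlgebra.coeff_single, Finsupp.single_apply, σ.injective.eq_iff]
    split_ifs <;> simp

/-- Evaluation of formal exponentials. -/
def expEval (φ : K →+* ℂ) : AddMonoidAlgebra K K →+* ℂ :=
  AddMonoidAlgebra.liftNCRingHom φ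
    { toFun := fun γ => Complex.exp (φ γ.toAdd)
      map_one' := by simp
      map_mul' := fun a b => by simp [Complex.exp_add] }
    fun _ _ => Commute.all _ _

theorem expEval_single (φ : K →+* ℂ) (γ c : K) :
    expEval φ (.single γ c) = φ c * Complex.exp (φ γ) := by
  simp [expEval]

theorem expEval_eq_sum (φ : K →+* ℂ) (u : AddMonoidAlgebra K K) :
    expEval φ u = ∑ γ ∈ u.coeff.support, φ (u.coeff γ) * Complex.exp (φ γ) := by
  conv_lhs => rw [← AddMonoidAlgebra.sum_coeff_single u]
  simp only [Finsupp.sum, map_sum, expEval_single]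

/-- A nonzero Galois-invariant formal combination of exponentials does not vanish. -/
theorem expEval_ne_zero_of_invariant [Algebra ℚ K] [FiniteDimensional ℚ K] [IsGalois ℚ K]
    (φ : K →+* ℂ) (U : AddMonoidAlgebra K K) (hU : U ≠ 0)
    (hinv : ∀ σ : K ≃ₐ[ℚ] K, twist σ U = U) : expEval φ U ≠ 0 := by
  classical
  intro hE
  have : CharZero K := algebraRat.charZero K
  obtain ⟨γ₀, hγ₀⟩ : ∃ γ, U.coeff γ ≠ 0 := by
    by_contra! h
    exact hU (AddMonoidAlgebra.ext (Finsupp.ext h))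
  -- Multiplying by this orbit sum keeps `U` invariant and its value zero, but moves weight to the
  -- exponent zero: the conjugate by `τ` pairs with the term of `U` at `τ γ₀` and contributes
  -- exactly 1, so the constant coefficient is the order of the Galois group.
  set W : AddMonoidAlgebra K K := ∑ τ : K ≃ₐ[ℚ] K, twist τ (.single (-γ₀) (U.coeff γ₀)⁻¹)
  set V := W * U
  have hW : ∀ σ, twist σ W = W := fun σ => by
    simp only [W, map_sum, twist_twist]
    exact Fintype.sum_equiv (Equiv.mulLeft σ) _ _ fun _ => rfl
  have hVinv : ∀ σ, twist σ V = V := fun σ => by simp only [V, map_mul, hW, hinv]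
  have hcoeff : ∀ (σ : K ≃ₐ[ℚ] K) γ, V.coeff (σ γ) = σ (V.coeff γ) := fun σ γ => by
    rw [← coeff_twist, hVinv]
  have hUc : ∀ (σ : K ≃ₐ[ℚ] K) γ, U.coeff (σ γ) = σ (U.coeff γ) := fun σ γ => by
    rw [← coeff_twist, hinv]
  have hV0 : V.coeff 0 ≠ 0 := by
    have h1 : V.coeff 0 = Fintype.card (K ≃ₐ[ℚ] K) := by
      simp only [V, W, Finset.sum_mul, AddMonoidAlgebra.coeff_sum, Finsupp.finsetSum_apply]
      rw [Finset.sum_congr rfl (g := fun _ => (1 : K))]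
      · simp
      · intro τ _
        rw [twist_single, AddMonoidAlgebra.coeff_single_mul_eq_mul_coeff (τ γ₀), hUc, map_inv₀,
          inv_mul_cancel₀]
        · simpa using hγ₀
        · intro m' _
          rw [map_neg, neg_add_eq_zero, eq_comm]
    rw [h1]
    exact_mod_cast Fintype.card_ne_zero
  refine add_sum_exp_ne_zero φ (V.coeff.support.erase 0) (by simp) ?_ V.coeff hcoeff hV0 ?_
  · intro σ γ hγ
    simp only [Finset.mem_erase, Finsupp.mem_support_iff, hcoeff] at hγ ⊢
    simpa using hγ
  · have h2 : expEval φ V = 0 := by simp only [V, map_mul, hE, mul_zero]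
    rw [expEval_eq_sum, ← Finset.add_sum_erase _ _ (Finsupp.mem_support_iff.2 hV0)] at h2
    simpa using h2

/-- The product of all Galois conjugates of the formal element `e^a - b` is invariant. It is nonzero
because the group algebra has no zero divisors, yet it would evaluate to zero through the factor of
the identity. -/
theorem exp_ne_of_ne_zero [Algebra ℚ K] [FiniteDimensional ℚ K] [IsGalois ℚ K]
    (φ : K →+* ℂ) {a : K} (ha : a ≠ 0) (b : K) : Complex.exp (φ a) ≠ φ b := by
  classical
  intro h
  set u : AddMonoidAlgebra K K := .single a 1 - .single 0 b
  have hu : u ≠ 0 := fun h0 => by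
    have := congrArg (fun w => w.coeff a) h0
    simp [u, ha.symm] at this
  have hEu : expEval φ u = 0 := by simp [u, expEval_single, h]
  refine expEval_ne_zero_of_invariant φ (∏ σ : K ≃ₐ[ℚ] K, twist σ u) ?_ ?_ ?_
  · refine Finset.prod_ne_zero_iff.2 fun σ _ h0 => hu ?_
    have h1 : twist σ⁻¹ (twist σ u) = u := by
      rw [twist_twist, inv_mul_cancel]
      refine AddMonoidAlgebra.ext (Finsupp.ext fun γ => ?_)
      exact coeff_twist 1 u γ
    rw [← h1, h0, map_zero]
  · intro σ
    rw [map_prod]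
    simp only [twist_twist]
    exact Fintype.prod_equiv (Equiv.mulLeft σ) _ _ fun _ => rfl
  · rw [map_prod]
    refine Finset.prod_eq_zero (Finset.mem_univ 1) ?_
    rw [show twist 1 u = u from AddMonoidAlgebra.ext (Finsupp.ext fun γ => coeff_twist 1 u γ), hEu]

end HermiteLindemann

/-- The **Hermite–Lindemann theorem**. -/
theorem transcendental_exp_of_isAlgebraic {a : ℂ} (ha : IsAlgebraic ℚ a) (ha0 : a ≠ 0) :
    Transcendental ℚ (Complex.exp a) := by
  intro hb
  set b := Complex.exp a
  -- The splitting field of this product is a single finite Galois extension containing both `a` and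
  -- `exp a`.
  set p : Polynomial ℚ := minpoly ℚ a * minpoly ℚ b
  have hp0 : p ≠ 0 := mul_ne_zero (minpoly.ne_zero ha.isIntegral) (minpoly.ne_zero hb.isIntegral)
  have : p.IsSplittingField ℚ (IntermediateField.adjoin ℚ (p.rootSet ℂ)) :=
    IntermediateField.adjoin_rootSet_isSplittingField (IsAlgClosed.splits _)
  set K := IntermediateField.adjoin ℚ (p.rootSet ℂ)
  have := Polynomial.IsSplittingField.finiteDimensional K p
  have := Normal.of_isSplittingField (F := ℚ) (E := K) p
  have : IsGalois ℚ K := {}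
  have haK : a ∈ K := IntermediateField.subset_adjoin _ _ (by
    rw [Polynomial.mem_rootSet]; exact ⟨hp0, by simp [p]⟩)
  have hbK : b ∈ K := IntermediateField.subset_adjoin _ _ (by
    rw [Polynomial.mem_rootSet]; exact ⟨hp0, by simp [p]⟩)
  exact HermiteLindemann.exp_ne_of_ne_zero (algebraMap K ℂ) (a := ⟨a, haK⟩)
    (fun h => ha0 (congrArg Subtype.val h)) ⟨b, hbK⟩ rfl

end

/-! ### The algebraic machine computes only algebraic numbers from algebraic input -/

theorem ArithOp.isAlgebraic_eval (op : ArithOp) {x y : ℝ} (hx : IsAlgebraic ℚ x)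
    (hy : IsAlgebraic ℚ y) : IsAlgebraic ℚ (op.eval x y) := by
  cases op
  · exact hx.add hy
  · exact hx.sub hy
  · exact hx.mul hy
  · simpa only [ArithOp.eval, div_eq_mul_inv] using hx.mul hy.inv

/-- The coefficients lie in the field of real algebraic numbers, so the root is algebraic over that
field, and algebraicity is transitive. -/
theorem isAlgebraic_of_mem_roots {p : Polynomial ℝ} (hp : ∀ k, IsAlgebraic ℚ (p.coeff k)) {x : ℝ}
    (hx : x ∈ p.roots) : IsAlgebraic ℚ x := by
  obtain ⟨hp0, hx⟩ := Polynomial.mem_roots'.1 hx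
  have hlift : p ∈ Polynomial.lifts (algebraMap (algebraicClosure ℚ ℝ) ℝ) := by
    rw [Polynomial.lifts_iff_coeff_lifts]
    exact fun k => ⟨⟨p.coeff k, mem_algebraicClosure_iff.2 (hp k)⟩, rfl⟩
  obtain ⟨q, rfl⟩ := (Polynomial.mem_lifts _).1 hlift
  have hxL : IsAlgebraic (algebraicClosure ℚ ℝ) x := by
    refine ⟨q, fun h => hp0 (by simp [h]), ?_⟩
    rwa [Polynomial.IsRoot.def, Polynomial.eval_map_algebraMap] at hx
  have : Algebra.IsAlgebraic ℚ (algebraicClosure ℚ ℝ) :=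
    ⟨fun z => (isAlgebraic_algebraMap_iff (A := ℝ) Subtype.val_injective).1
      (mem_algebraicClosure_iff.1 z.2)⟩
  exact hxL.restrictScalars ℚ

theorem isAlgebraic_realRoot {c : ℕ → ℝ} (hc : ∀ k, IsAlgebraic ℚ (c k)) (d m : ℕ) :
    IsAlgebraic ℚ (realRoot c d m) := by
  unfold realRoot
  rw [List.getD_eq_getElem?_getD]
  rcases h : (Finset.sort _ _ : List ℝ)[m]? with _ | x
  -- A missing root yields the default value 0, which is algebraic as well.
  · simpa using isAlgebraic_zero
  · have hx := List.mem_of_getElem? h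
    rw [Finset.mem_sort, Multiset.mem_toFinset] at hx
    refine isAlgebraic_of_mem_roots (fun k => ?_) hx
    rw [Polynomial.finsetSum_coeff]
    simp only [Polynomial.coeff_monomial, Finset.sum_ite_eq']
    split_ifs
    · exact hc k
    · exact isAlgebraic_zero

theorem isAlgebraic_update {f : ℕ → ℝ} (hf : ∀ k, IsAlgebraic ℚ (f k)) {a : ℝ}
    (ha : IsAlgebraic ℚ a) (i k : ℕ) : IsAlgebraic ℚ (Function.update f i a k) := by
  rw [Function.update_apply]
  split_ifs
  exacts [ha, hf k]

theorem Instr.isAlgebraic_exec {σ : MachineState} (hσ : ∀ k, IsAlgebraic ℚ (σ.mem k)) (ins : Instr)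
    (k : ℕ) : IsAlgebraic ℚ ((ins.exec σ).mem k) := by
  cases ins with
  | const i c hc => exact isAlgebraic_update hσ hc i k
  | arith op i j l => exact isAlgebraic_update hσ (op.isAlgebraic_eval (hσ j) (hσ l)) i k
  | solve i a d m => exact isAlgebraic_update hσ (isAlgebraic_realRoot (fun _ => hσ _) _ _) i k
  | load i a => exact isAlgebraic_update hσ (hσ _) i k
  | store a i => exact isAlgebraic_update hσ (hσ _) _ k
  | _ => exact hσ k

theorem Program.isAlgebraic_iterate_step (P : Program) {σ : MachineState}
    (hσ : ∀ k, IsAlgebraic ℚ (σ.mem k)) (t k : ℕ) : IsAlgebraic ℚ ((P.step^[t] σ).mem k) := by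
  induction t generalizing k with
  | zero => exact hσ k
  | succ t ih =>
    rw [Function.iterate_succ_apply']
    generalize P.step^[t] σ = τ at ih
    unfold Program.step
    split
    · exact ih k
    · exact Instr.isAlgebraic_exec ih _ k

/-- Algebraicity of all real cells is an invariant of every instruction, so the control flow and the
running time play no role. -/
theorem AlgebraicallyComputable.isAlgebraic {S : Finset Plane} {A : S → ℝ}
    (hS : ∀ s ∈ S, HasAlgebraicCoordinates s) (hA : ∀ s, IsAlgebraic ℚ (A s)) {r : ℝ}
    (hr : AlgebraicallyComputable S A r) : IsAlgebraic ℚ r := by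
  obtain ⟨P, l, -, -, t, -, rfl⟩ := hr
  refine P.isAlgebraic_iterate_step (fun k => ?_) t 0
  unfold initialState
  simp only [List.getD_eq_getElem?_getD]
  rcases h : (l.flatMap fun s : S => [(s : Plane) 0, (s : Plane) 1, A s])[k]? with _ | x
  -- Cells beyond the input start at 0.
  · simpa using isAlgebraic_zero
  · obtain ⟨s, -, hs⟩ := List.mem_flatMap.1 (List.mem_of_getElem? h)
    simp only [List.mem_cons, List.not_mem_nil, or_false] at hs
    rcases hs with rfl | rfl | rfl
    exacts [hS s s.2 0, hS s s.2 1, hA s]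

/-! ### Transcendence of the radius -/

/-- Otherwise `sin θ` and `exp (iθ) = cos θ + i sin θ` would be algebraic, with `iθ` algebraic and
nonzero. -/
theorem not_isAlgebraic_of_isAlgebraic_cos {θ : ℝ} (hθ : θ ≠ 0)
    (hcos : IsAlgebraic ℚ (Real.cos θ)) : ¬ IsAlgebraic ℚ θ := by
  intro hθa
  have hI : IsAlgebraic ℚ Complex.I := by
    refine ⟨Polynomial.X ^ 2 + 1, ?_, by simp⟩
    exact (Polynomial.monic_X_pow_add_C (1 : ℚ) two_ne_zero).ne_zero
  have h1 : IsAlgebraic ℚ (θ : ℂ) := hθa.algebraMap (A := ℂ)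
  have hc : IsAlgebraic ℚ ((Real.cos θ : ℝ) : ℂ) := hcos.algebraMap (A := ℂ)
  have hs : IsAlgebraic ℚ ((Real.sin θ : ℝ) : ℂ) := by
    have h2 : IsAlgebraic ℚ (((Real.sin θ : ℝ) : ℂ) ^ 2) := by
      have h3 : ((Real.sin θ : ℝ) : ℂ) ^ 2 = 1 - ((Real.cos θ : ℝ) : ℂ) ^ 2 := by
        rw [← Complex.ofReal_pow, Real.sin_sq]
        push_cast
        ring
      rw [h3]
      exact isAlgebraic_one.sub (hc.pow 2)
    exact h2.of_pow two_pos
  refine transcendental_exp_of_isAlgebraic (h1.mul hI)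
    (mul_ne_zero (by exact_mod_cast hθ) Complex.I_ne_zero) ?_
  rw [Complex.exp_mul_I, ← Complex.ofReal_cos, ← Complex.ofReal_sin]
  exact hc.add (hs.mul hI)

/-- The equation can be solved for the angle `π - arccos (b / r)` by algebraic operations on `b` and
`r`, while the cosine of that angle is `-b / r`. The angle exceeds `π / 2`, so it is not zero. -/
theorem not_isAlgebraic_radius {b r : ℝ} (hb : IsAlgebraic ℚ b) (hb0 : 0 < b) (hbr : b < r)
    (h : r ^ 2 * (Real.pi - Real.arccos (b / r)) + b * √(r ^ 2 - b ^ 2) = 1) :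
    ¬ IsAlgebraic ℚ r := by
  intro hr
  have hr0 : 0 < r := hb0.trans hbr
  have hdiv : ∀ {x y : ℝ}, IsAlgebraic ℚ x → IsAlgebraic ℚ y → IsAlgebraic ℚ (x / y) :=
    fun hx hy => ArithOp.isAlgebraic_eval .div hx hy
  have hbr1 : b / r ≤ 1 := (div_le_one hr0).2 hbr.le
  have hbr0 : 0 < b / r := by positivity
  have hcos : Real.cos (Real.pi - Real.arccos (b / r)) = -(b / r) := by
    rw [Real.cos_pi_sub, Real.cos_arccos (by linarith) hbr1]
  refine not_isAlgebraic_of_isAlgebraic_cos (θ := Real.pi - Real.arccos (b / r)) ?_ ?_ ?_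
  · have := Real.arccos_lt_pi_div_two.2 hbr0
    have := Real.pi_pos
    intro h
    linarith
  · rw [hcos]
    exact (hdiv hb hr).neg
  · have hs : IsAlgebraic ℚ (√(r ^ 2 - b ^ 2)) := by
      refine IsAlgebraic.of_pow two_pos ?_
      rw [Real.sq_sqrt (by nlinarith)]
      exact (hr.pow 2).sub (hb.pow 2)
    have heq : Real.pi - Real.arccos (b / r) = (1 - b * √(r ^ 2 - b ^ 2)) / r ^ 2 := by
      field_simp
      linarith
    rw [heq]
    exact hdiv (isAlgebraic_one.sub (hb.mul hs)) (hr.pow 2)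

/-! ### Half disks and their area -/

/-- The points at distance at most `R` from `s` that are not closer to `t`. -/
def halfDisk (s t : Plane) (R : ℝ) : Set Plane := {p | dist p s ≤ R ∧ dist p s ≤ dist p t}

/-- The points at distance less than `R` from `s` that are closer to `s` than to `t`. -/
def openHalfDisk (s t : Plane) (R : ℝ) : Set Plane := {p | dist p s < R ∧ dist p s < dist p t}

theorem isOpen_openHalfDisk (s t : Plane) (R : ℝ) : IsOpen (openHalfDisk s t R) := by
  simp only [openHalfDisk, Set.ofPred_and]
  exact (isOpen_lt (by fun_prop) (by fun_prop)).inter (isOpen_lt (by fun_prop) (by fun_prop))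

theorem isClosed_halfDisk (s t : Plane) (R : ℝ) : IsClosed (halfDisk s t R) := by
  simp only [halfDisk, Set.ofPred_and]
  exact (isClosed_le (by fun_prop) (by fun_prop)).inter (isClosed_le (by fun_prop) (by fun_prop))

theorem openHalfDisk_subset_halfDisk (s t : Plane) (R : ℝ) :
    openHalfDisk s t R ⊆ halfDisk s t R := fun _ hp => ⟨hp.1.le, hp.2.le⟩

/-- The difference lies on a circle and a line, both of area zero; only for `R = 0` does the circle
degenerate to a point. -/
theorem volume_halfDisk_eq_openHalfDisk {s t : Plane} (hst : s ≠ t) (R : ℝ) :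
    volume (halfDisk s t R) = volume (openHalfDisk s t R) := by
  refine le_antisymm ?_ (measure_mono (openHalfDisk_subset_halfDisk s t R))
  have hbis : volume (AffineSubspace.perpBisector s t : Set Plane) = 0 :=
    Measure.addHaar_affineSubspace _ _ fun h => hst (AffineSubspace.perpBisector_eq_top.1 h)
  by_cases hR : R = 0
  · subst hR
    have : halfDisk s t 0 ⊆ {s} := fun p hp => by
      simpa using le_antisymm hp.1 dist_nonneg
    exact (measure_mono this).trans (by simp)
  have hsph : volume (Metric.sphere s R) = 0 := Measure.addHaar_sphere_of_ne_zero _ _ hR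
  have hsub : halfDisk s t R ⊆
      openHalfDisk s t R ∪ (Metric.sphere s R ∪ AffineSubspace.perpBisector s t) := by
    rintro p ⟨h1, h2⟩
    rcases h1.lt_or_eq with h1 | h1
    · rcases h2.lt_or_eq with h2 | h2
      · exact Or.inl ⟨h1, h2⟩
      · exact Or.inr (Or.inr (AffineSubspace.mem_perpBisector_iff_dist_eq.2 h2))
    · exact Or.inr (Or.inl h1)
  calc volume (halfDisk s t R) ≤ _ := measure_mono hsub
    _ ≤ volume (openHalfDisk s t R) + (volume (Metric.sphere s R)
          + volume (AffineSubspace.perpBisector s t : Set Plane)) :=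
        (measure_union_le _ _).trans (by gcongr; exact measure_union_le _ _)
    _ = volume (openHalfDisk s t R) := by rw [hsph, hbis]; simp

theorem volume_halfDisk_lt_top (s t : Plane) (R : ℝ) : volume (halfDisk s t R) < ⊤ :=
  (measure_mono (fun _ hp => hp.1 : halfDisk s t R ⊆ Metric.closedBall s R)).trans_lt
    measure_closedBall_lt_top

theorem volume_halfDisk_lt {s t : Plane} (hst : s ≠ t) {R R' : ℝ} (hR : 0 ≤ R) (h : R < R') :
    volume (halfDisk s t R) < volume (halfDisk s t R') := by
  set B : Set Plane := {p | R < dist p s} ∩ openHalfDisk s t R'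
  have hB : IsOpen B :=
    (isOpen_lt (by fun_prop) (by fun_prop)).inter (isOpen_openHalfDisk s t R')
  have hd : 0 < ‖s - t‖ := norm_pos_iff.2 (sub_ne_zero.2 hst)
  have hBne : B.Nonempty := by
    -- The witness lies on the line through the sites, beyond `s` as seen from `t`, at distance
    -- midway between `R` and `R'`.
    set l := (R + R') / 2 / ‖s - t‖
    have hl : 0 < l := div_pos (by linarith) hd
    have h1 : dist (s + l • (s - t)) s = (R + R') / 2 := by
      rw [dist_eq_norm, add_sub_cancel_left, norm_smul, Real.norm_of_nonneg hl.le,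
        div_mul_cancel₀ _ hd.ne']
    have h2 : dist (s + l • (s - t)) t = (R + R') / 2 + ‖s - t‖ := by
      rw [dist_eq_norm, show s + l • (s - t) - t = (l + 1) • (s - t) by module, norm_smul,
        Real.norm_of_nonneg (by linarith), add_mul, div_mul_cancel₀ _ hd.ne', one_mul]
    refine ⟨s + l • (s - t), ?_, ?_, ?_⟩
    · rw [Set.mem_ofPred_eq, h1]; linarith
    · rw [h1]; linarith
    · rw [h1, h2]; linarith
  have hdisj : Disjoint (halfDisk s t R) B :=
    Set.disjoint_left.2 fun p hp hp' => absurd hp.1 (not_le.2 hp'.1)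
  have hsub : halfDisk s t R ∪ B ⊆ halfDisk s t R' :=
    Set.union_subset (fun p hp => ⟨hp.1.trans h.le, hp.2⟩)
      (Set.inter_subset_right.trans (openHalfDisk_subset_halfDisk s t R'))
  calc volume (halfDisk s t R) < volume (halfDisk s t R) + volume B :=
        ENNReal.lt_add_right (volume_halfDisk_lt_top s t R).ne (hB.measure_pos volume hBne).ne'
    _ = volume (halfDisk s t R ∪ B) := (measure_union hdisj hB.measurableSet).symm
    _ ≤ _ := measure_mono hsub

/-- The point reflection `p ↦ s + t - p` exchanges the two sites and preserves area. -/
theorem volume_halfDisk_comm (s t : Plane) (R : ℝ) :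
    volume (halfDisk t s R) = volume (halfDisk s t R) := by
  have h := (Measure.measurePreserving_sub_left (volume : Measure Plane) (s + t)).measure_preimage
    (isClosed_halfDisk s t R).measurableSet.nullMeasurableSet
  rw [← h]
  congr 1
  ext p
  have h1 : dist (s + t - p) s = dist p t := by
    rw [dist_comm p t, dist_eq_norm, dist_eq_norm]; congr 1; abel
  have h2 : dist (s + t - p) t = dist p s := by
    rw [dist_comm p s, dist_eq_norm, dist_eq_norm]; congr 1; abel
  simp only [halfDisk, Set.mem_preimage, Set.mem_ofPred_eq, h1, h2]

/-- The area of a half disk of radius `R` around `s` cut off at distance `b` from the center. -/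
noncomputable def halfDiskArea (b R : ℝ) : ℝ :=
  R ^ 2 * (Real.pi - Real.arccos (b / R)) + b * √(R ^ 2 - b ^ 2)

/-- The derivative is the length of the chord at signed distance `u` from the center, so this
function measures area by slicing. -/
theorem hasDerivAt_arcsin_add_mul_sqrt {R u : ℝ} (hR : 0 < R) (h1 : -R < u) (h2 : u < R) :
    HasDerivAt (fun u => R ^ 2 * Real.arcsin (u / R) + u * √(R ^ 2 - u ^ 2))
      (2 * √(R ^ 2 - u ^ 2)) u := by
  have hpos : 0 < R ^ 2 - u ^ 2 := by nlinarith
  have hs : 0 < √(R ^ 2 - u ^ 2) := Real.sqrt_pos.2 hpos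
  have hsq : √(R ^ 2 - u ^ 2) ^ 2 = R ^ 2 - u ^ 2 := Real.sq_sqrt hpos.le
  have hdiv : HasDerivAt (fun u : ℝ => u / R) (1 / R) u := (hasDerivAt_id u).div_const R
  have harc := (Real.hasDerivAt_arcsin (x := u / R)
    (by rw [ne_eq, div_eq_iff hR.ne']; linarith) (by rw [ne_eq, div_eq_iff hR.ne']; linarith)).comp
      u hdiv
  have hsqrt : HasDerivAt (fun u : ℝ => √(R ^ 2 - u ^ 2)) (-(2 * u) / (2 * √(R ^ 2 - u ^ 2))) u := by
    have := ((hasDerivAt_pow 2 u).const_sub (R ^ 2)).sqrt hpos.ne'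
    simpa using this
  refine ((harc.const_mul (R ^ 2)).add ((hasDerivAt_id u).mul hsqrt)).congr_deriv ?_
  have e : √(1 - (u / R) ^ 2) = √(R ^ 2 - u ^ 2) / R := by
    rw [show 1 - (u / R) ^ 2 = (R ^ 2 - u ^ 2) / R ^ 2 by field_simp, Real.sqrt_div hpos.le,
      Real.sqrt_sq hR.le]
  rw [e]
  simp only [id]
  field_simp
  rw [hsq]
  ring

theorem integral_two_mul_sqrt {b R : ℝ} (hR : 0 < R) (hb : -R ≤ b) (hbR : b ≤ R) :
    ∫ u in (-R)..b, 2 * √(R ^ 2 - u ^ 2) = halfDiskArea b R := by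
  rw [intervalIntegral.integral_eq_sub_of_hasDerivAt_of_le hb
    (f := fun u => R ^ 2 * Real.arcsin (u / R) + u * √(R ^ 2 - u ^ 2))]
  · rw [halfDiskArea, Real.arccos, neg_div, div_self hR.ne', Real.arcsin_neg, Real.arcsin_one]
    have : R ^ 2 - (-R) ^ 2 = 0 := by ring
    rw [this, Real.sqrt_zero]
    ring
  · exact Continuous.continuousOn
      ((continuous_const.mul (Real.continuous_arcsin.comp (continuous_id.div_const R))).add
        (by fun_prop))
  · exact fun u hu => hasDerivAt_arcsin_add_mul_sqrt hR hu.1 (hu.2.trans_le hbR)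
  · exact Continuous.intervalIntegrable (by fun_prop) _ _

/-- With the site moved to the origin the bisector becomes the line `u = b`, and the open half disk
is the union of the vertical chords over `-R < u < b`. For `R < b` the line would miss the disk and
the formula would fail. -/
theorem volume_openHalfDisk_of_sites {x y b R : ℝ} (hb : 0 < b) (hbR : b ≤ R) :
    volume (openHalfDisk !₂[x - b, y] !₂[x + b, y] R) = ENNReal.ofReal (halfDiskArea b R) := by
  have hR : 0 < R := hb.trans_le hbR
  set e : Plane → ℝ × ℝ := fun p => (p 0 - (x - b), p 1 - y)
  have he : MeasurePreserving e volume volume := by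
    have h1 := (volume_preserving_finTwoArrow ℝ).comp
      (EuclideanSpace.volume_preserving_symm_measurableEquiv_toLp (Fin 2))
    have h2 : MeasurePreserving (fun q : ℝ × ℝ => q - (x - b, y)) volume volume :=
      measurePreserving_sub_right volume (x - b, y)
    exact h2.comp h1
  have hset : openHalfDisk !₂[x - b, y] !₂[x + b, y] R = e ⁻¹'
      regionBetween (fun u => -√(R ^ 2 - u ^ 2)) (fun u => √(R ^ 2 - u ^ 2)) (Set.Ioo (-R) b) := by
    ext p
    simp only [openHalfDisk, Set.mem_ofPred_eq, Set.mem_preimage, regionBetween, e,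
      EuclideanSpace.dist_eq, Fin.sum_univ_two, Real.dist_eq, sq_abs, Set.mem_Ioo]
    have key : √((p 0 - (x - b)) ^ 2 + (p 1 - y) ^ 2) < √((p 0 - (x + b)) ^ 2 + (p 1 - y) ^ 2) ↔
        p 0 - (x - b) < b := by
      rw [Real.sqrt_lt_sqrt_iff (by positivity)]
      constructor <;> intro h <;> nlinarith
    have hlt : √((p 0 - (x - b)) ^ 2 + (p 1 - y) ^ 2) < R ↔
        (p 0 - (x - b)) ^ 2 + (p 1 - y) ^ 2 < R ^ 2 := Real.sqrt_lt' hR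
    have hmid : (-√(R ^ 2 - (p 0 - (x - b)) ^ 2) < p 1 - y ∧
        p 1 - y < √(R ^ 2 - (p 0 - (x - b)) ^ 2)) ↔
        (p 0 - (x - b)) ^ 2 + (p 1 - y) ^ 2 < R ^ 2 := by
      rw [← abs_lt, Real.lt_sqrt (abs_nonneg _), sq_abs]
      constructor <;> intro h <;> linarith
    simp only [Matrix.cons_val_zero, Matrix.cons_val_one, key, hlt, hmid]
    constructor
    · rintro ⟨h1, h2⟩
      refine ⟨⟨?_, h2⟩, h1⟩
      nlinarith [sq_nonneg (p 1 - y)]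
    · rintro ⟨⟨-, h2⟩, h1⟩
      exact ⟨h1, h2⟩
  rw [hset, he.measure_preimage (measurableSet_regionBetween (by fun_prop) (by fun_prop)
    measurableSet_Ioo).nullMeasurableSet]
  have hint : ∀ c : ℝ, IntegrableOn (fun u => c * √(R ^ 2 - u ^ 2)) (Set.Ioo (-R) b) := fun c =>
    (Continuous.integrableOn_Icc (by fun_prop)).mono_set Set.Ioo_subset_Icc_self
  rw [Measure.volume_eq_prod, volume_regionBetween_eq_integral (by simpa using hint (-1))
    (by simpa using hint 1) measurableSet_Ioo
    (fun u _ => (neg_nonpos.2 (Real.sqrt_nonneg _)).trans (Real.sqrt_nonneg _)),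
    ← integral_two_mul_sqrt hR (by linarith) hbR, intervalIntegral.integral_of_le (by linarith),
    integral_Ioc_eq_integral_Ioo]
  congr 2
  ext u
  simp only [Pi.sub_apply]
  ring

theorem continuousOn_halfDiskArea {b : ℝ} : ContinuousOn (halfDiskArea b) (Set.Ioi 0) := by
  unfold halfDiskArea
  refine ContinuousOn.add (ContinuousOn.mul (by fun_prop) (continuousOn_const.sub ?_)) (by fun_prop)
  exact Real.continuous_arccos.comp_continuousOn
    (continuousOn_const.div continuousOn_id fun x hx => ne_of_gt hx)

theorem halfDiskArea_self {b : ℝ} (hb : 0 < b) : halfDiskArea b b = Real.pi * b ^ 2 := by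
  simp [halfDiskArea, div_self hb.ne']
  ring

theorem sites_ne {x y b : ℝ} (hb : b ≠ 0) : (!₂[x - b, y] : Plane) ≠ !₂[x + b, y] := by
  intro h
  have := congrArg (fun p : Plane => p 0) h
  simp at this
  exact hb (by linarith)

theorem volume_halfDisk_of_sites {x y b R : ℝ} (hb : 0 < b) (hbR : b ≤ R) :
    volume (halfDisk !₂[x - b, y] !₂[x + b, y] R) = ENNReal.ofReal (halfDiskArea b R) := by
  rw [volume_halfDisk_eq_openHalfDisk (sites_ne hb.ne'), volume_openHalfDisk_of_sites hb hbR]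

theorem pi_mul_sq_lt_one {b : ℝ} (hb : 0 < b) (hb' : b < √(1 / Real.pi)) :
    Real.pi * b ^ 2 < 1 := by
  have := (Real.lt_sqrt hb.le).1 hb'
  rwa [lt_div_iff₀ Real.pi_pos, mul_comm] at this

/-- Intermediate values between `b` and 1: at radius `b` the area is that of the full disk, `π b² <
1`, and at radius 1 it is at least `π / 2`. -/
theorem exists_halfDiskArea_eq_one {b : ℝ} (hb : 0 < b) (hb' : b < √(1 / Real.pi)) :
    ∃ r, b < r ∧ halfDiskArea b r = 1 := by
  have hlt := pi_mul_sq_lt_one hb hb'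
  have hb1 : b < 1 := by nlinarith [Real.pi_gt_three]
  have h0 : halfDiskArea b b < 1 := by rwa [halfDiskArea_self hb]
  have h1 : 1 ≤ halfDiskArea b 1 := by
    have h2 := Real.arccos_le_pi_div_two.2 hb.le
    have h3 := Real.pi_gt_three
    have h4 := mul_nonneg hb.le (Real.sqrt_nonneg (1 ^ 2 - b ^ 2))
    rw [halfDiskArea, div_one]
    linarith
  obtain ⟨r, hr, hr1⟩ := intermediate_value_Icc hb1.le
    (continuousOn_halfDiskArea.mono fun z hz => hb.trans_le hz.1) ⟨h0.le, h1⟩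
  refine ⟨r, lt_of_le_of_ne hr.1 ?_, hr1⟩
  rintro rfl
  exact h0.ne hr1

/-- Monotonicity is read off from the strict growth of the half disks themselves, placed at an
arbitrary midpoint, instead of from a derivative. -/
theorem halfDiskArea_lt {b R R' : ℝ} (hb : 0 < b) (hbR : b ≤ R) (h : R < R') :
    halfDiskArea b R < halfDiskArea b R' := by
  have := volume_halfDisk_lt (sites_ne (x := 0) (y := 0) hb.ne') (hb.le.trans hbR) h
  rw [volume_halfDisk_of_sites hb hbR, volume_halfDisk_of_sites hb (hbR.trans h.le)] at this
  exact (ENNReal.ofReal_lt_ofReal_iff').1 this |>.1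

/-! ### Half disks and the complement of two disks are regular closed -/

theorem dist_le_dist_iff_inner (p s t : Plane) :
    dist p s ≤ dist p t ↔ 2 * inner ℝ (p - s) (t - s) ≤ ‖t - s‖ ^ 2 := by
  have h : dist p t ^ 2 = dist p s ^ 2 - 2 * inner ℝ (p - s) (t - s) + ‖t - s‖ ^ 2 := by
    rw [dist_eq_norm, dist_eq_norm, ← norm_sub_sq_real, sub_sub_sub_cancel_right]
  rw [← sq_le_sq₀ dist_nonneg dist_nonneg, h]
  constructor <;> intro h <;> linarith

theorem dist_lt_dist_iff_inner (p s t : Plane) :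
    dist p s < dist p t ↔ 2 * inner ℝ (p - s) (t - s) < ‖t - s‖ ^ 2 := by
  have h : dist p t ^ 2 = dist p s ^ 2 - 2 * inner ℝ (p - s) (t - s) + ‖t - s‖ ^ 2 := by
    rw [dist_eq_norm, dist_eq_norm, ← norm_sub_sq_real, sub_sub_sub_cancel_right]
  rw [← sq_lt_sq₀ dist_nonneg dist_nonneg, h]
  constructor <;> intro h <;> linarith

/-- The half disk is star-shaped about `s`: shrinking towards `s` by a factor `τ < 1` makes both
inequalities strict. -/
theorem halfDisk_subset_closure {s t : Plane} (hst : s ≠ t) {r : ℝ} (hr : 0 < r) :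
    halfDisk s t r ⊆ closure (openHalfDisk s t r) := by
  rintro p ⟨h1, h2⟩
  have hlim : Filter.Tendsto (fun τ : ℝ => s + τ • (p - s)) (nhdsWithin 1 (Set.Iio 1)) (nhds p) := by
    have : Continuous fun τ : ℝ => s + τ • (p - s) := by fun_prop
    simpa using (this.tendsto 1).mono_left nhdsWithin_le_nhds
  refine mem_closure_of_tendsto hlim ?_
  have hev : ∀ᶠ τ : ℝ in nhdsWithin 1 (Set.Iio 1), 0 < τ :=
    nhdsWithin_le_nhds (lt_mem_nhds zero_lt_one)
  filter_upwards [hev, self_mem_nhdsWithin] with τ h0 hτ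
  rw [Set.mem_Iio] at hτ
  have hd : 0 < ‖t - s‖ ^ 2 := by
    have := norm_pos_iff.2 (sub_ne_zero.2 hst.symm)
    positivity
  refine ⟨?_, ?_⟩
  · rw [dist_eq_norm, add_sub_cancel_left, norm_smul, Real.norm_of_nonneg h0.le, ← dist_eq_norm]
    nlinarith
  · rw [dist_lt_dist_iff_inner, add_sub_cancel_left, real_inner_smul_left]
    rw [dist_le_dist_iff_inner] at h2
    rcases le_or_gt (inner ℝ (p - s) (t - s)) 0 with h | h <;> nlinarith

/-- The points at distance at least `r` from both `s` and `t`. -/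
def outerRegion (s t : Plane) (r : ℝ) : Set Plane := {p | r ≤ dist p s ∧ r ≤ dist p t}

/-- The points at distance more than `r` from both `s` and `t`. -/
def openOuterRegion (s t : Plane) (r : ℝ) : Set Plane := {p | r < dist p s ∧ r < dist p t}

theorem isClosed_outerRegion (s t : Plane) (R : ℝ) : IsClosed (outerRegion s t R) := by
  simp only [outerRegion, Set.ofPred_and]
  exact (isClosed_le (by fun_prop) (by fun_prop)).inter (isClosed_le (by fun_prop) (by fun_prop))

/-- The origin is inside the disk of radius `r` about `-d` and `q` is not in its interior, so moving
on along the ray through `q` leaves the disk strictly. -/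
theorem norm_smul_add_gt {q d : Plane} {r τ : ℝ} (hr : ‖d‖ < r) (h : r ≤ ‖q + d‖) (hτ : 1 < τ) :
    r < ‖τ • q + d‖ := by
  have hd := norm_nonneg d
  have hr0 : 0 ≤ r := hd.trans hr.le
  have h1 : r ^ 2 ≤ ‖q + d‖ ^ 2 := by gcongr
  have h2 : ‖d‖ ^ 2 < r ^ 2 := by gcongr
  rw [norm_add_sq_real] at h1
  refine lt_of_pow_lt_pow_left₀ 2 (norm_nonneg _) ?_
  rw [norm_add_sq_real, norm_smul, real_inner_smul_left, Real.norm_of_nonneg (by linarith)]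
  have h3 : 0 < ‖q‖ ^ 2 + 2 * inner ℝ q d := by linarith
  nlinarith [mul_pos (sub_pos.2 hτ) h3, mul_nonneg (mul_nonneg (zero_le_one.trans hτ.le)
    (sub_pos.2 hτ).le) (sq_nonneg ‖q‖)]

/-- The midpoint `m` of the sites is interior to both disks, so pushing `p` radially away from `m`
leaves both at once. -/
theorem outerRegion_subset_closure {s t : Plane} {r : ℝ} (hr : dist s t < 2 * r) :
    outerRegion s t r ⊆ closure (openOuterRegion s t r) := by
  rintro p ⟨h1, h2⟩
  set m : Plane := (1 / 2 : ℝ) • (s + t) with hm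
  set d : Plane := (1 / 2 : ℝ) • (t - s) with hd
  have hs : s = m - d := by rw [hm, hd]; module
  have ht : t = m + d := by rw [hm, hd]; module
  have hdr : ‖d‖ < r := by
    rw [hd, norm_smul, ← dist_eq_norm, dist_comm]
    norm_num
    linarith
  have hlim : Filter.Tendsto (fun τ : ℝ => m + τ • (p - m)) (nhdsWithin 1 (Set.Ioi 1)) (nhds p) := by
    have : Continuous fun τ : ℝ => m + τ • (p - m) := by fun_prop
    simpa using (this.tendsto 1).mono_left nhdsWithin_le_nhds
  refine mem_closure_of_tendsto hlim ?_
  filter_upwards [self_mem_nhdsWithin] with τ hτ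
  rw [hs, dist_eq_norm, show p - (m - d) = (p - m) + d by abel] at h1
  rw [ht, dist_eq_norm, show p - (m + d) = (p - m) + -d by abel] at h2
  refine ⟨?_, ?_⟩
  · rw [hs, dist_eq_norm, show m + τ • (p - m) - (m - d) = τ • (p - m) + d by abel]
    exact norm_smul_add_gt hdr h1 hτ
  · rw [ht, dist_eq_norm, show m + τ • (p - m) - (m + d) = τ • (p - m) + -d by abel]
    exact norm_smul_add_gt (by rwa [norm_neg]) h2 hτ

/-! ### Stable diagrams of two sites -/

namespace Diagram

variable {S : Finset Plane} {D : Diagram S}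

/-- `R` is the largest distance from `s` of a point of its region. -/
def IsMaxDist (D : Diagram S) (s : S) (R : ℝ) : Prop :=
  (∀ p ∈ D.region (some s), dist p s ≤ R) ∧ ∃ p ∈ D.region (some s), dist p s = R

theorem IsMaxDist.isBoundingRadius {s : S} {R : ℝ} (h : D.IsMaxDist s R) :
    D.IsBoundingRadius s R := by
  obtain ⟨h1, p, hp, rfl⟩ := h
  exact ⟨⟨dist_nonneg, h1⟩, fun ρ hρ => hρ.2 hp⟩

namespace IsStableMatching

variable {A : S → ℝ}

theorem notMem_of_mem_interior (h : D.IsStableMatching A) {i j : Option S} (hij : i ≠ j)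
    {p : Plane} (hp : p ∈ interior (D.region i)) : p ∉ D.region j := fun hj =>
  (h.inter_subset i j hij ⟨interior_subset hp, hj⟩).1.2 hp

theorem exists_mem_region (h : D.IsStableMatching A) (p : Plane) : ∃ i, p ∈ D.region i :=
  Set.mem_iUnion.1 (h.iUnion_region ▸ Set.mem_univ p)

/-- A site with an unbounded region would prefer every point to some point it has, so no unmatched
point could lie outside its region. The regions of the sites, of finite total area, would then cover
the plane. -/
theorem isBounded_region (h : D.IsStableMatching A) (s : S) :
    Bornology.IsBounded (D.region (some s)) := by
  by_contra hb
  have hfar : ∀ p : Plane, ∃ p' ∈ D.region (some s), dist p s < dist p' s := by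
    by_contra! hcon
    obtain ⟨p, hp⟩ := hcon
    exact hb (Metric.isBounded_closedBall.subset fun p' hp' => hp p' hp')
  have hcov : (Set.univ : Set Plane) ⊆ ⋃ u : S, D.region (some u) := by
    intro p _
    obtain ⟨i, hi⟩ := h.exists_mem_region p
    rcases i with _ | u
    · refine Set.mem_iUnion.2 ⟨s, ?_⟩
      by_contra hps
      exact h.stable s p ⟨hps, hfar p, Or.inl hi⟩
    · exact Set.mem_iUnion.2 ⟨u, hi⟩
  have hlt : volume (Set.univ : Set Plane) < ⊤ :=
    calc volume (Set.univ : Set Plane) ≤ volume (⋃ u : S, D.region (some u)) := measure_mono hcov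
      _ ≤ ∑ u : S, volume (D.region (some u)) := measure_iUnion_fintype_le _ _
      _ < ⊤ := ENNReal.sum_lt_top.2 fun u _ => by
        rw [h.area_region]
        exact ENNReal.ofReal_lt_top
  exact absurd hlt (by simp)

theorem exists_isMaxDist (h : D.IsStableMatching A) (s : S) (hA : 0 < A s) :
    ∃ R, D.IsMaxDist s R := by
  have hne : (D.region (some s)).Nonempty := by
    refine nonempty_of_measure_ne_zero (μ := volume) ?_
    rw [h.area_region]
    simpa using hA
  obtain ⟨p, hp, hmax⟩ := (Metric.isCompact_of_isClosed_isBounded (h.isClosed_region _)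
    (h.isBounded_region s)).exists_isMaxOn hne
      (f := fun p => dist p (s : Plane)) (by fun_prop)
  exact ⟨dist p s, fun q hq => hmax hq, p, hp, rfl⟩

variable {s t : S} {R R' : ℝ}

/-- A point of the open half disk outside the region of `s` would be unmatched or belong to the more
distant `t`, and would block with `s`. -/
theorem openHalfDisk_subset (h : D.IsStableMatching A) (hS : ∀ u, u = s ∨ u = t)
    (hR : D.IsMaxDist s R) : openHalfDisk s t R ⊆ D.region (some s) := by
  rintro p ⟨h1, h2⟩
  by_contra hps
  obtain ⟨-, p', hp', hd⟩ := hR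
  obtain ⟨i, hi⟩ := h.exists_mem_region p
  refine h.stable s p ⟨hps, ⟨p', hp', hd ▸ h1⟩, ?_⟩
  rcases i with _ | u
  · exact Or.inl hi
  · rcases hS u with rfl | rfl
    · exact absurd hi hps
    · exact Or.inr ⟨u, hi, h2⟩

/-- A point of the region closer to `t` would, as `R ≤ R'`, lie in the open half disk of `t`, hence
in the interior of the region of `t`. -/
theorem region_subset_halfDisk (h : D.IsStableMatching A) (hst : s ≠ t)
    (hS : ∀ u, u = s ∨ u = t) (hR : D.IsMaxDist s R) (hR' : D.IsMaxDist t R') (hle : R ≤ R') :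
    D.region (some s) ⊆ halfDisk s t R := by
  intro p hp
  refine ⟨hR.1 p hp, ?_⟩
  by_contra! hlt
  have hmem : p ∈ openHalfDisk t s R' := ⟨hlt.trans_le ((hR.1 p hp).trans hle), hlt⟩
  exact h.notMem_of_mem_interior (i := some t) (by simpa using hst.symm)
    (interior_maximal (h.openHalfDisk_subset (fun u => (hS u).symm) hR')
      (isOpen_openHalfDisk _ _ _) hmem) hp

theorem volume_halfDisk_le (h : D.IsStableMatching A) (hst : s ≠ t)
    (hS : ∀ u, u = s ∨ u = t) (hR : D.IsMaxDist s R) :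
    volume (halfDisk s t R) ≤ ENNReal.ofReal (A s) := by
  rw [volume_halfDisk_eq_openHalfDisk (fun e => hst (Subtype.ext e)), ← h.area_region]
  exact measure_mono (h.openHalfDisk_subset hS hR)

theorem volume_halfDisk_eq (h : D.IsStableMatching A) (hst : s ≠ t)
    (hS : ∀ u, u = s ∨ u = t) (hR : D.IsMaxDist s R) (hR' : D.IsMaxDist t R') (hle : R ≤ R') :
    volume (halfDisk s t R) = ENNReal.ofReal (A s) := by
  refine le_antisymm (h.volume_halfDisk_le hst hS hR) ?_
  rw [← h.area_region]
  exact measure_mono (h.region_subset_halfDisk hst hS hR hR' hle)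

/-- The site with the smaller radius has a region of exactly the area of its half disk. The other
half disk would be strictly larger, yet may not exceed the same appetite. -/
theorem not_maxDist_lt (h : D.IsStableMatching A) (hst : s ≠ t) (hS : ∀ u, u = s ∨ u = t)
    (hA : A s = A t) (hR : D.IsMaxDist s R) (hR' : D.IsMaxDist t R') : ¬ R < R' := by
  intro hlt
  have h1 := h.volume_halfDisk_eq hst hS hR hR' hlt.le
  have h2 := h.volume_halfDisk_le hst.symm (fun u => (hS u).symm) hR'
  rw [volume_halfDisk_comm, ← hA, ← h1] at h2
  obtain ⟨-, p, -, hp⟩ := hR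
  exact absurd (volume_halfDisk_lt (fun e => hst (Subtype.ext e)) (hp ▸ dist_nonneg) hlt)
    (not_lt.2 h2)

theorem exists_common_maxDist (h : D.IsStableMatching A) (hst : s ≠ t)
    (hS : ∀ u, u = s ∨ u = t) (hA : A s = A t) (hpos : 0 < A s) :
    ∃ r, 0 ≤ r ∧ D.IsMaxDist s r ∧ D.IsMaxDist t r ∧
      volume (halfDisk s t r) = ENNReal.ofReal (A s) := by
  obtain ⟨R, hR⟩ := h.exists_isMaxDist s hpos
  obtain ⟨R', hR'⟩ := h.exists_isMaxDist t (hA ▸ hpos)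
  have e : R = R' := le_antisymm
    (not_lt.1 (h.not_maxDist_lt hst.symm (fun u => (hS u).symm) hA.symm hR' hR))
    (not_lt.1 (h.not_maxDist_lt hst hS hA hR hR'))
  subst e
  obtain ⟨-, p, -, hp⟩ := id hR
  exact ⟨R, hp ▸ dist_nonneg, hR, hR', h.volume_halfDisk_eq hst hS hR hR' le_rfl⟩

end IsStableMatching

end Diagram

/-! ### Existence of a stable diagram of two sites -/

/-- Each point of a disk of radius `r` around a site goes to the nearest site. -/
def nearestDiagram (S : Finset Plane) (r : ℝ) : Diagram S where
  region
    | none => {p | ∀ v : S, r ≤ dist p v}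
    | some u => {p | dist p u ≤ r ∧ ∀ v : S, dist p u ≤ dist p v}

section nearestDiagram

variable {S : Finset Plane} {s t : S} {r : ℝ}

theorem nearestDiagram_region_some (hS : ∀ u, u = s ∨ u = t) :
    (nearestDiagram S r).region (some s) = halfDisk s t r := by
  ext p
  constructor
  · exact fun h => ⟨h.1, h.2 t⟩
  · refine fun h => ⟨h.1, fun v => ?_⟩
    rcases hS v with rfl | rfl
    exacts [le_rfl, h.2]

theorem nearestDiagram_region_none (hS : ∀ u, u = s ∨ u = t) :
    (nearestDiagram S r).region none = outerRegion s t r := by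
  ext p
  constructor
  · exact fun h => ⟨h s, h t⟩
  · intro h v
    rcases hS v with rfl | rfl
    exacts [h.1, h.2]

theorem isStableMatching_nearestDiagram (hst : s ≠ t) (hS : ∀ u, u = s ∨ u = t)
    (hr : dist (s : Plane) t < 2 * r) (hvol : volume (halfDisk s t r) = 1) :
    (nearestDiagram S r).IsStableMatching fun _ => 1 := by
  have hr0 : 0 < r := by linarith [dist_nonneg (x := (s : Plane)) (y := t)]
  have hne : (s : Plane) ≠ t := fun e => hst (Subtype.ext e)
  have hS' : ∀ u, u = t ∨ u = s := fun u => (hS u).symm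
  have hs := nearestDiagram_region_some (r := r) hS
  have ht := nearestDiagram_region_some (r := r) hS'
  have hn := nearestDiagram_region_none (r := r) hS
  -- Each region lies in the closure of an open set missed by all other regions, so no interior
  -- point of another region can belong to it. This is what puts intersections on both frontiers.
  have hcore : ∀ i, ∃ O : Set Plane, (nearestDiagram S r).region i ⊆ closure O ∧
      ∀ j, j ≠ i → Disjoint ((nearestDiagram S r).region j) O := by
    rintro (_ | u)
    · refine ⟨openOuterRegion s t r, hn ▸ outerRegion_subset_closure hr, ?_⟩
      rintro (_ | v) hv
      · exact absurd rfl hv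
      · refine Set.disjoint_left.2 fun p hp hp' => ?_
        rcases hS v with rfl | rfl
        exacts [absurd hp.1 (not_le.2 hp'.1), absurd hp.1 (not_le.2 hp'.2)]
    · obtain ⟨w, huw, hw⟩ : ∃ w : S, u ≠ w ∧ ∀ v, v = u ∨ v = w := by
        rcases hS u with rfl | rfl
        exacts [⟨t, hst, hS⟩, ⟨s, hst.symm, hS'⟩]
      refine ⟨openHalfDisk u w r, ?_, ?_⟩
      · rw [nearestDiagram_region_some hw]
        exact halfDisk_subset_closure (fun e => huw (Subtype.ext e)) hr0
      · rintro (_ | v) hv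
        · exact Set.disjoint_left.2 fun p hp hp' => absurd (hp u) (not_le.2 hp'.1)
        · refine Set.disjoint_left.2 fun p hp hp' => ?_
          rcases hw v with rfl | rfl
          · exact absurd rfl hv
          · exact absurd (hp.2 u) (not_le.2 hp'.2)
  have hclosed : ∀ i, IsClosed ((nearestDiagram S r).region i) := by
    rintro (_ | u)
    · exact hn ▸ isClosed_outerRegion _ _ _
    · rcases hS u with rfl | rfl
      exacts [hs ▸ isClosed_halfDisk _ _ _, ht ▸ isClosed_halfDisk _ _ _]
  have hint : ∀ i j, i ≠ j →
      Disjoint (interior ((nearestDiagram S r).region i)) ((nearestDiagram S r).region j) := by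
    intro i j hij
    obtain ⟨O, hO, hdisj⟩ := hcore j
    exact (((hdisj i hij).mono_left interior_subset).closure_right isOpen_interior).mono_right hO
  refine ⟨hclosed, ?_, ?_, ?_, ?_⟩
  · refine Set.eq_univ_of_forall fun p => Set.mem_iUnion.2 ?_
    by_cases hp : r ≤ dist p s ∧ r ≤ dist p t
    · exact ⟨none, hn ▸ hp⟩
    · rcases le_total (dist p s) (dist p t) with h | h
      · refine ⟨some s, hs ▸ ⟨?_, h⟩⟩
        by_contra! hc
        exact hp ⟨hc.le, hc.le.trans h⟩
      · refine ⟨some t, ht ▸ ⟨?_, h⟩⟩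
        by_contra! hc
        exact hp ⟨hc.le.trans h, hc.le⟩
  · rintro i j hij p ⟨hi, hj⟩
    rw [(hclosed i).frontier_eq, (hclosed j).frontier_eq]
    exact ⟨⟨hi, fun h => Set.disjoint_left.1 (hint i j hij) h hj⟩,
      ⟨hj, fun h => Set.disjoint_left.1 (hint j i hij.symm) h hi⟩⟩
  · intro u
    rcases hS u with rfl | rfl
    · rw [hs, hvol, ENNReal.ofReal_one]
    · rw [ht, volume_halfDisk_comm, hvol, ENNReal.ofReal_one]
  · rintro u p ⟨-, ⟨p', hp', hlt⟩, hp | ⟨v, hv, hlt'⟩⟩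
    · exact absurd (hp u) (not_le.2 (hlt.trans_le hp'.1))
    · exact absurd (hv.2 u) (not_le.2 hlt')

end nearestDiagram

/-! ### Circular arcs -/

theorem IsClosed.isClosed_connectedComponentIn {X : Type*} [TopologicalSpace X] {A : Set X}
    (hA : IsClosed A) (x : X) : IsClosed (connectedComponentIn A x) := by
  by_cases hx : x ∈ A
  · refine isClosed_of_closure_subset ?_
    exact isPreconnected_connectedComponentIn.closure.subset_connectedComponentIn
      (subset_closure (mem_connectedComponentIn hx))
      (closure_minimal (connectedComponentIn_subset A x) hA)
  · rw [connectedComponentIn_eq_empty hx]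
    exact isClosed_empty

/-- The points at distance `r` from `s` that are not closer to `t`. -/
def arcSet (s t : Plane) (r : ℝ) : Set Plane := {p | dist p s = r ∧ dist p s ≤ dist p t}

theorem dist_site_sq (x y b : ℝ) (p : Plane) :
    dist p !₂[x - b, y] ^ 2 = (p 0 - (x - b)) ^ 2 + (p 1 - y) ^ 2 := by
  rw [EuclideanSpace.dist_eq, Real.sq_sqrt (by positivity)]
  simp [Fin.sum_univ_two, Real.dist_eq, sq_abs]

theorem dist_other_site_sq (x y b : ℝ) (p : Plane) :
    dist p !₂[x + b, y] ^ 2 = (p 0 - (x + b)) ^ 2 + (p 1 - y) ^ 2 := by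
  simpa using dist_site_sq x y (-b) p

theorem dist_site_le_iff (x y b : ℝ) (p : Plane) :
    dist p !₂[x - b, y] ≤ dist p !₂[x + b, y] ↔ b * (p 0 - x) ≤ 0 := by
  rw [← sq_le_sq₀ dist_nonneg dist_nonneg, dist_site_sq, dist_other_site_sq]
  constructor <;> intro h <;> nlinarith

theorem dist_site_eq_iff {x y b : ℝ} (hb : b ≠ 0) (p : Plane) :
    dist p !₂[x - b, y] = dist p !₂[x + b, y] ↔ p 0 = x := by
  rw [← sq_eq_sq₀ dist_nonneg dist_nonneg, dist_site_sq, dist_other_site_sq]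
  constructor
  · intro h
    have : b * (p 0 - x) = 0 := by linarith
    linarith [(mul_eq_zero.1 this).resolve_left hb]
  · rintro rfl
    ring

namespace CircularArc

variable (γ : CircularArc)

theorem point_zero (θ : ℝ) : γ.point θ 0 = γ.center 0 + γ.radius * Real.cos θ := by
  simp [point]

theorem point_one (θ : ℝ) : γ.point θ 1 = γ.center 1 + γ.radius * Real.sin θ := by
  simp [point]

theorem continuous_point : Continuous γ.point := by
  have : Continuous fun θ : ℝ => (!₂[Real.cos θ, Real.sin θ] : Plane) := by
    refine (PiLp.continuous_toLp 2 _).comp (continuous_pi fun i => ?_)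
    fin_cases i
    exacts [Real.continuous_cos, Real.continuous_sin]
  exact continuous_const.add (this.const_smul γ.radius)

theorem periodic_point : Function.Periodic γ.point (2 * Real.pi) := fun θ => by
  simp [point]

theorem isPreconnected_carrier : IsPreconnected γ.carrier :=
  isPreconnected_Icc.image _ γ.continuous_point.continuousOn

theorem nonempty_carrier : γ.carrier.Nonempty :=
  ⟨γ.point γ.start, γ.start, ⟨le_rfl, by linarith [γ.extent_pos]⟩, rfl⟩

/-- An arc contained in the union of a circle and a vertical line lies on the circle. -/
theorem center_eq_and_radius_eq {x y b c r : ℝ} (hr : 0 < r)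
    (h : ∀ p ∈ γ.carrier, dist p !₂[x - b, y] = r ∨ p 0 = c) :
    γ.center = !₂[x - b, y] ∧ γ.radius = r := by
  -- `f` vanishes on the line and `g` on the circle. Their product is analytic and zero on an
  -- interval of angles, so one factor is identically zero; it is not `f`, because the cosine is not
  -- constant.
  set f : ℝ → ℝ := fun θ => γ.center 0 + γ.radius * Real.cos θ - c
  set g : ℝ → ℝ := fun θ => (γ.center 0 + γ.radius * Real.cos θ - (x - b)) ^ 2 +
    (γ.center 1 + γ.radius * Real.sin θ - y) ^ 2 - r ^ 2
  have hf : AnalyticOnNhd ℝ f Set.univ := fun θ _ => by fun_prop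
  have hg : AnalyticOnNhd ℝ g Set.univ := fun θ _ => by fun_prop
  have hext := γ.extent_pos
  have hmid : γ.start + γ.extent / 2 ∈ Set.Ioo γ.start (γ.start + γ.extent) :=
    ⟨by linarith, by linarith⟩
  have hfg : ∀ θ ∈ Set.univ, (f * g) θ = 0 := by
    have := (hf.mul hg).eqOn_zero_of_preconnected_of_eventuallyEq_zero isPreconnected_univ
      (Set.mem_univ (γ.start + γ.extent / 2)) ?_
    · exact fun θ hθ => this hθ
    · filter_upwards [Ioo_mem_nhds hmid.1 hmid.2] with θ hθ
      rcases h (γ.point θ) ⟨θ, ⟨hθ.1.le, hθ.2.le⟩, rfl⟩ with h | h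
      · have := dist_site_sq x y b (γ.point θ)
        rw [h, point_zero, point_one] at this
        simp only [Pi.zero_apply, g]
        rw [← this, sub_self, mul_zero]
      · rw [point_zero] at h
        simp only [Pi.zero_apply, f]
        rw [h, sub_self, zero_mul]
  have hρ := γ.radius_pos
  have hg0 : ∀ θ, g θ = 0 := by
    rcases hf.eq_zero_or_eq_zero_of_mul_eq_zero hg hfg isPreconnected_univ with h | h
    · have h1 := h 0 (Set.mem_univ _)
      have h2 := h Real.pi (Set.mem_univ _)
      simp only [f, Real.cos_zero, Real.cos_pi] at h1 h2
      linarith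
    · exact fun θ => h θ (Set.mem_univ _)
  -- Opposite points of the circle give the center by subtraction, and then any one of them gives
  -- the radius.
  have h1 := hg0 0
  have h2 := hg0 Real.pi
  have h3 := hg0 (Real.pi / 2)
  have h4 := hg0 (-(Real.pi / 2))
  simp only [g, Real.cos_zero, Real.cos_pi, Real.sin_zero, Real.sin_pi, Real.cos_pi_div_two,
    Real.sin_pi_div_two, Real.cos_neg, Real.sin_neg] at h1 h2 h3 h4
  have e0 : γ.center 0 = x - b := by
    have : γ.radius * (γ.center 0 - (x - b)) = 0 := by linarith
    linarith [(mul_eq_zero.1 this).resolve_left hρ.ne']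
  have e1 : γ.center 1 = y := by
    have : γ.radius * (γ.center 1 - y) = 0 := by linarith
    linarith [(mul_eq_zero.1 this).resolve_left hρ.ne']
  refine ⟨?_, ?_⟩
  · ext i
    fin_cases i
    exacts [by simpa using e0, by simpa using e1]
  · rw [e0, e1] at h1
    exact (sq_eq_sq₀ hρ.le hr.le).1 (by linarith)

/-- The points of a circle around a site that are not closer to the other site form an arc. -/
theorem exists_carrier_eq_arcSet {x y b r : ℝ} (hb : b ≠ 0) (hr : |b| < r) :
    ∃ γ : CircularArc, γ.carrier = arcSet !₂[x - b, y] !₂[x + b, y] r := by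
  have hb0 : 0 < |b| := abs_pos.2 hb
  have hr0 : 0 < r := hb0.trans hr
  -- The angle `c` points from the site away from the other one, and `σ` is its cosine. The arc is
  -- symmetric about this direction.
  obtain ⟨c, σ, hcos, hsin, hσ, hσb⟩ : ∃ c σ : ℝ, (∀ φ, Real.cos (c + φ) = σ * Real.cos φ) ∧
      (∀ φ, Real.sin (c + φ) = σ * Real.sin φ) ∧ σ * σ = 1 ∧ b * σ = -|b| := by
    rcases lt_or_gt_of_ne hb with h | h
    · exact ⟨0, 1, by simp, by simp, by simp, by simp [abs_of_neg h]⟩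
    · refine ⟨Real.pi, -1, ?_, ?_, by simp, by simp [abs_of_pos h]⟩
      · intro φ; rw [add_comm, Real.cos_add_pi]; ring
      · intro φ; rw [add_comm, Real.sin_add_pi]; ring
  set ω := Real.arccos (-(|b| / r))
  have hω : 0 < ω := Real.arccos_pos.2 (by have := div_pos hb0 hr0; linarith)
  have hωπ : ω ≤ Real.pi := Real.arccos_le_pi _
  have hdiv : |b| / r < 1 := (div_lt_one hr0).2 hr
  have hcosω : Real.cos ω = -(|b| / r) :=
    Real.cos_arccos (by linarith) (by have := div_pos hb0 hr0; linarith)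
  have hbb : b * b = |b| * |b| := (abs_mul_abs_self b).symm
  have hiff : ∀ φ, -(b * b) - |b| * r * Real.cos φ ≤ 0 ↔ -(|b| / r) ≤ Real.cos φ := by
    intro φ
    rw [← neg_div, div_le_iff₀ hr0, hbb]
    constructor
    · intro h
      by_contra! hc
      nlinarith
    · intro h
      nlinarith
  let γ : CircularArc := ⟨!₂[x - b, y], r, hr0, c - ω, 2 * ω, by linarith, by linarith⟩
  have hpt : ∀ φ, γ.point (c + φ) = !₂[x - b + r * (σ * Real.cos φ), y + r * (σ * Real.sin φ)] := by
    intro φ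
    ext i
    fin_cases i
    · simp [point, γ, hcos]
    · simp [point, γ, hsin]
  refine ⟨γ, Set.Subset.antisymm ?_ ?_⟩
  · rintro _ ⟨θ, ⟨h1, h2⟩, rfl⟩
    obtain ⟨φ, rfl⟩ : ∃ φ, θ = c + φ := ⟨θ - c, by ring⟩
    simp only [γ] at h1 h2
    have hφ : |φ| ≤ ω := abs_le.2 ⟨by linarith, by linarith⟩
    rw [hpt]
    refine ⟨?_, ?_⟩
    · refine (sq_eq_sq₀ dist_nonneg hr0.le).1 ?_
      rw [dist_site_sq]
      simp only [Matrix.cons_val_zero, Matrix.cons_val_one]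
      linear_combination r ^ 2 * (Real.cos φ ^ 2 + Real.sin φ ^ 2) * hσ +
        r ^ 2 * Real.sin_sq_add_cos_sq φ
    · rw [dist_site_le_iff]
      simp only [Matrix.cons_val_zero]
      have : -(b * b) - |b| * r * Real.cos φ ≤ 0 := by
        rw [hiff, ← hcosω, ← Real.cos_abs φ]
        exact Real.cos_le_cos_of_nonneg_of_le_pi (abs_nonneg _) hωπ hφ
      linear_combination this + r * Real.cos φ * hσb
  · rintro p ⟨h1, h2⟩
    have hd := dist_site_sq x y b p
    rw [h1] at hd
    rw [dist_site_le_iff] at h2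
    -- This is `p` relative to the site, turned so that the axis of the arc is the positive real
    -- axis; its argument is then the parameter of `p`.
    set z : ℂ := ⟨σ * (p 0 - (x - b)), σ * (p 1 - y)⟩
    have hz : ‖z‖ = r := by
      refine (sq_eq_sq₀ (norm_nonneg _) hr0.le).1 ?_
      rw [Complex.sq_norm, Complex.normSq_apply]
      simp only [z]
      linear_combination ((p 0 - (x - b)) ^ 2 + (p 1 - y) ^ 2) * hσ - hd
    have hre : r * Real.cos z.arg = σ * (p 0 - (x - b)) := by
      rw [← hz]; exact Complex.norm_mul_cos_arg z
    have him : r * Real.sin z.arg = σ * (p 1 - y) := by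
      rw [← hz]; exact Complex.norm_mul_sin_arg z
    have hφ : |z.arg| ≤ ω := by
      have hc : -(|b| / r) ≤ Real.cos z.arg := by
        rw [← hiff]
        linear_combination h2 + b * (p 0 - (x - b)) * hσ - r * Real.cos z.arg * hσb + b * σ * hre
      rw [← Real.cos_abs] at hc
      rw [← Real.arccos_cos (abs_nonneg z.arg) (Complex.abs_arg_le_pi z)]
      exact Real.arccos_le_arccos hc
    have hφ' := abs_le.1 hφ
    refine ⟨c + z.arg, ⟨?_, ?_⟩, ?_⟩
    · simp only [γ]; linarith
    · simp only [γ]; linarith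
    · rw [hpt]
      ext i
      fin_cases i
      · simp only [Fin.zero_eta, Matrix.cons_val_zero]
        linear_combination σ * hre + (p 0 - (x - b)) * hσ
      · simp only [Fin.mk_one, Matrix.cons_val_one, Matrix.cons_val_fin_one]
        linear_combination σ * him + (p 1 - y) * hσ

/-- The points of `arcSet` on the bisector are endpoints of the arc. -/
theorem isEndpoint_of_carrier_eq_arcSet {x y b r : ℝ} (hb : b ≠ 0) (hr : |b| < r)
    (hc : γ.center = !₂[x - b, y]) (hrad : γ.radius = r)
    (hcar : γ.carrier = arcSet !₂[x - b, y] !₂[x + b, y] r) {p : Plane} (hp : p ∈ γ.carrier)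
    (hpx : p 0 = x) : γ.IsEndpoint p := by
  by_contra hend
  have hr0 : 0 < r := (abs_nonneg b).trans_lt hr
  obtain ⟨θ₀, hθ₀, rfl⟩ := id hp
  have hle : ∀ θ, γ.point θ ∈ γ.carrier → b * (x - b + r * Real.cos θ - x) ≤ 0 := by
    intro θ hθ
    rw [hcar] at hθ
    have := (dist_site_le_iff _ _ _ _).1 hθ.2
    rwa [point_zero, hc, hrad] at this
  -- Away from endpoints the arc continues on both sides of `θ₀`; a full circle does so everywhere
  -- by periodicity.
  have hmem : ∀ᶠ θ in nhds θ₀, γ.point θ ∈ γ.carrier := by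
    rcases γ.extent_le.lt_or_eq with hlt | heq
    · have h1 : θ₀ ≠ γ.start := fun e => hend ⟨hlt, Or.inl (by rw [e])⟩
      have h2 : θ₀ ≠ γ.start + γ.extent := fun e => hend ⟨hlt, Or.inr (by rw [e])⟩
      filter_upwards [Ioo_mem_nhds (lt_of_le_of_ne hθ₀.1 h1.symm) (lt_of_le_of_ne hθ₀.2 h2)]
        with θ hθ
      exact ⟨θ, ⟨hθ.1.le, hθ.2.le⟩, rfl⟩
    · refine Filter.Eventually.of_forall fun θ => ?_
      rw [carrier, heq, γ.periodic_point.image_Icc Real.two_pi_pos]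
      exact ⟨θ, rfl⟩
  have hcos : r * Real.cos θ₀ = b := by
    rw [point_zero, hc, hrad] at hpx
    simp only [Matrix.cons_val_zero] at hpx
    linarith
  -- The arc would touch the bisector from one side, so `sin θ₀ = 0` and `r = |b|`. A circle with `r
  -- > |b|` crosses the bisector transversally instead.
  have hmax : IsLocalMax (fun θ => b * (x - b + r * Real.cos θ - x)) θ₀ := by
    filter_upwards [hmem] with θ hθ
    refine (hle θ hθ).trans (le_of_eq ?_)
    rw [hcos]
    ring
  have hder : HasDerivAt (fun θ => b * (x - b + r * Real.cos θ - x))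
      (b * (r * -Real.sin θ₀)) θ₀ :=
    ((((Real.hasDerivAt_cos θ₀).const_mul r).const_add (x - b)).sub_const x).const_mul b
  have hsin : Real.sin θ₀ = 0 := by
    have := hmax.hasDerivAt_eq_zero hder
    simpa [hb, hr0.ne'] using this
  have h1 := Real.sin_sq_add_cos_sq θ₀
  rw [hsin] at h1
  have h2 : r ^ 2 = |b| ^ 2 := by
    rw [sq_abs, ← hcos]
    linear_combination -(r ^ 2) * h1
  nlinarith [abs_nonneg b]

end CircularArc

/-! ### General position of two sites -/

namespace Diagram.IsStableMatching

variable {S : Finset Plane} {D : Diagram S} {A : S → ℝ} {s t : S} {r : ℝ}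

theorem dist_eq_of_mem_region_of_mem_none (h : D.IsStableMatching A) (hst : s ≠ t)
    (hS : ∀ u, u = s ∨ u = t) (hs : D.IsMaxDist s r) (ht : D.IsMaxDist t r) {p : Plane}
    (hp : p ∈ D.region (some s)) (hp' : p ∈ D.region none) :
    dist p s = r ∨ dist p s = dist p t := by
  have hmem := h.region_subset_halfDisk hst hS hs ht le_rfl hp
  rcases hmem.1.lt_or_eq with h1 | h1
  · rcases hmem.2.lt_or_eq with h2 | h2
    · exact absurd hp' (h.notMem_of_mem_interior (i := some s) (by simp)
        (interior_maximal (h.openHalfDisk_subset hS hs) (isOpen_openHalfDisk _ _ _) ⟨h1, h2⟩))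
    · exact Or.inr h2
  · exact Or.inl h1

theorem arcSet_subset_region (h : D.IsStableMatching A) (hst : s ≠ t)
    (hS : ∀ u, u = s ∨ u = t) (hs : D.IsMaxDist s r) (hr : 0 < r) :
    arcSet s t r ⊆ D.region (some s) := fun _ hp =>
  closure_minimal (h.openHalfDisk_subset hS hs) (h.isClosed_region _)
    (halfDisk_subset_closure (fun e => hst (Subtype.ext e)) hr ⟨hp.1.le, hp.2⟩)

theorem arcSet_subset_none (h : D.IsStableMatching A) (hS : ∀ u, u = s ∨ u = t)
    (hs : D.IsMaxDist s r) (ht : D.IsMaxDist t r) (hr : dist (s : Plane) t < 2 * r) :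
    arcSet s t r ⊆ D.region none := fun _ hp => by
  refine closure_minimal ?_ (h.isClosed_region _)
    (outerRegion_subset_closure hr ⟨hp.1.ge, hp.1.ge.trans hp.2⟩)
  intro q hq
  obtain ⟨i, hi⟩ := h.exists_mem_region q
  rcases i with _ | u
  · exact hi
  · rcases hS u with rfl | rfl
    exacts [absurd (hs.1 q hi) (not_le.2 hq.1), absurd (ht.1 q hi) (not_le.2 hq.2)]

variable {x y b : ℝ}

/-- Common points of the two regions lie on the circle or the bisector, so the edge lies on the
circle. The whole arc is connected and contained in both regions, hence in the same two faces, and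
maximality makes it the edge. -/
theorem carrier_eq_arcSet_of_subset_region_none (h : D.IsStableMatching A) (hst : s ≠ t)
    (hS : ∀ u, u = s ∨ u = t) (hs : D.IsMaxDist s r) (ht : D.IsMaxDist t r)
    (es : (s : Plane) = !₂[x - b, y]) (et : (t : Plane) = !₂[x + b, y]) (hb : b ≠ 0)
    (hr : |b| < r) {γ : CircularArc} {i j : Option S}
    (hij : i = some s ∧ j = none ∨ i = none ∧ j = some s) {z z' : Plane}
    (hγ : γ.carrier ⊆ frontier (connectedComponentIn (D.region i) z) ∩
      frontier (connectedComponentIn (D.region j) z'))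
    (hmax : ∀ γ' : CircularArc, γ'.carrier ⊆ frontier (connectedComponentIn (D.region i) z) ∩
      frontier (connectedComponentIn (D.region j) z') → γ.carrier ⊆ γ'.carrier →
        γ'.carrier = γ.carrier) :
    γ.center = s ∧ γ.radius = r ∧ γ.carrier = arcSet s t r := by
  have hr0 : 0 < r := (abs_nonneg b).trans_lt hr
  have hdist : dist (s : Plane) t < 2 * r := by
    refine lt_of_pow_lt_pow_left₀ 2 (by linarith) ?_
    rw [es, et, dist_other_site_sq]
    simp only [Matrix.cons_val_zero, Matrix.cons_val_one]
    nlinarith [sq_abs b, abs_nonneg b]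
  have hfr : ∀ k w, frontier (connectedComponentIn (D.region k) w) ⊆
      connectedComponentIn (D.region k) w := fun k w =>
    ((h.isClosed_region k).isClosed_connectedComponentIn w).frontier_subset
  have harcs := h.arcSet_subset_region hst hS hs hr0
  have harcn := h.arcSet_subset_none hS hs ht hdist
  have harci : arcSet s t r ⊆ D.region i := by rcases hij with ⟨rfl, -⟩ | ⟨rfl, -⟩ <;> assumption
  have harcj : arcSet s t r ⊆ D.region j := by rcases hij with ⟨-, rfl⟩ | ⟨-, rfl⟩ <;> assumption
  have hne : i ≠ j := by rcases hij with ⟨rfl, rfl⟩ | ⟨rfl, rfl⟩ <;> simp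
  have hreg : ∀ p ∈ γ.carrier, p ∈ D.region (some s) ∧ p ∈ D.region none := by
    intro p hp
    have h1 := connectedComponentIn_subset _ _ (hfr _ _ (hγ hp).1)
    have h2 := connectedComponentIn_subset _ _ (hfr _ _ (hγ hp).2)
    rcases hij with ⟨rfl, rfl⟩ | ⟨rfl, rfl⟩
    exacts [⟨h1, h2⟩, ⟨h2, h1⟩]
  have hcr : γ.center = !₂[x - b, y] ∧ γ.radius = r := by
    refine γ.center_eq_and_radius_eq (c := x) hr0 fun p hp => ?_
    have := h.dist_eq_of_mem_region_of_mem_none hst hS hs ht (hreg p hp).1 (hreg p hp).2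
    rwa [es, et, dist_site_eq_iff hb] at this
  have hsub : γ.carrier ⊆ arcSet s t r := by
    intro p hp
    refine ⟨?_, (h.region_subset_halfDisk hst hS hs ht le_rfl (hreg p hp).1).2⟩
    obtain ⟨θ, -, rfl⟩ := hp
    refine (sq_eq_sq₀ dist_nonneg hr0.le).1 ?_
    rw [es, dist_site_sq, γ.point_zero, γ.point_one, hcr.1, hcr.2]
    simp only [Matrix.cons_val_zero, Matrix.cons_val_one]
    linear_combination r ^ 2 * Real.sin_sq_add_cos_sq θ
  refine ⟨hcr.1.trans es.symm, hcr.2, ?_⟩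
  obtain ⟨Γ, hΓ⟩ := CircularArc.exists_carrier_eq_arcSet (x := x) (y := y) hb hr
  rw [← es, ← et] at hΓ
  rw [← hΓ]
  refine (hmax Γ ?_ (hΓ ▸ hsub)).symm
  obtain ⟨q, hq⟩ := γ.nonempty_carrier
  have hcomp : ∀ {k w}, q ∈ connectedComponentIn (D.region k) w → arcSet s t r ⊆ D.region k →
      Γ.carrier ⊆ connectedComponentIn (D.region k) w := by
    intro k w hqk hk
    rw [connectedComponentIn_eq hqk]
    exact Γ.isPreconnected_carrier.subset_connectedComponentIn (hΓ ▸ hsub hq) (hΓ ▸ hk)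
  have hΓi := hcomp (hfr _ _ (hγ hq).1) harci
  have hΓj := hcomp (hfr _ _ (hγ hq).2) harcj
  intro p hp
  refine ⟨⟨subset_closure (hΓi hp), fun hint => ?_⟩, ⟨subset_closure (hΓj hp), fun hint => ?_⟩⟩
  · exact h.notMem_of_mem_interior hne
      (interior_mono (connectedComponentIn_subset _ _) hint) (harcj (hΓ ▸ hp))
  · exact h.notMem_of_mem_interior hne.symm
      (interior_mono (connectedComponentIn_subset _ _) hint) (harci (hΓ ▸ hp))

theorem not_carrier_subset_region_inter (h : D.IsStableMatching A) (hst : s ≠ t)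
    (hS : ∀ u, u = s ∨ u = t) (hs : D.IsMaxDist s r) (ht : D.IsMaxDist t r)
    (es : (s : Plane) = !₂[x - b, y]) (et : (t : Plane) = !₂[x + b, y]) (hb : b ≠ 0)
    (γ : CircularArc) : ¬ ∀ p ∈ γ.carrier, p ∈ D.region (some s) ∧ p ∈ D.region (some t) := by
  intro hγ
  have hline : ∀ p ∈ γ.carrier, p 0 = x := by
    intro p hp
    have h1 := h.region_subset_halfDisk hst hS hs ht le_rfl (hγ p hp).1
    have h2 := h.region_subset_halfDisk hst.symm (fun u => (hS u).symm) ht hs le_rfl (hγ p hp).2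
    have := le_antisymm h1.2 h2.2
    rwa [es, et, dist_site_eq_iff hb] at this
  -- An arc inside the line alone would satisfy the circle-or-line condition for every radius; 1 and
  -- 2 already contradict each other.
  have h1 := (γ.center_eq_and_radius_eq (x := x) (b := b) (y := y) one_pos
    fun p hp => Or.inr (hline p hp)).2
  have h2 := (γ.center_eq_and_radius_eq (x := x) (b := b) (y := y) two_pos
    fun p hp => Or.inr (hline p hp)).2
  linarith

theorem center_eq_and_carrier_eq_arcSet (h : D.IsStableMatching A) (hst : s ≠ t)
    (hS : ∀ u, u = s ∨ u = t) (hs : D.IsMaxDist s r) (ht : D.IsMaxDist t r)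
    (es : (s : Plane) = !₂[x - b, y]) (et : (t : Plane) = !₂[x + b, y]) (hb : b ≠ 0)
    (hr : |b| < r) {γ : CircularArc} (hγ : D.IsCurvedEdge γ) :
    γ.radius = r ∧ (γ.center = s ∧ γ.carrier = arcSet s t r ∨
      γ.center = t ∧ γ.carrier = arcSet t s r) := by
  obtain ⟨_, _, ⟨i, z, hz, rfl⟩, ⟨j, z', hz', rfl⟩, hne, hsub, hmax⟩ := hγ
  have hS' : ∀ u, u = t ∨ u = s := fun u => (hS u).symm
  -- Exchanging the sites amounts to replacing `b` by `-b`, which is why the arc lemmas assume `|b|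
  -- < r` and no sign.
  have et' : (t : Plane) = !₂[x - -b, y] := by simpa using et
  have es' : (s : Plane) = !₂[x + -b, y] := by simpa [sub_eq_add_neg] using es
  have hr' : |(-b)| < r := by rwa [abs_neg]
  have hfr : ∀ k w, frontier (connectedComponentIn (D.region k) w) ⊆
      connectedComponentIn (D.region k) w := fun k w =>
    ((h.isClosed_region k).isClosed_connectedComponentIn w).frontier_subset
  have hcs : (i = some s ∧ j = none ∨ i = none ∧ j = some s) →
      γ.radius = r ∧ (γ.center = s ∧ γ.carrier = arcSet s t r ∨
        γ.center = t ∧ γ.carrier = arcSet t s r) := fun hij => by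
    obtain ⟨h1, h2, h3⟩ := h.carrier_eq_arcSet_of_subset_region_none hst hS hs ht es et hb hr hij
      hsub hmax
    exact ⟨h2, Or.inl ⟨h1, h3⟩⟩
  have hct : (i = some t ∧ j = none ∨ i = none ∧ j = some t) →
      γ.radius = r ∧ (γ.center = s ∧ γ.carrier = arcSet s t r ∨
        γ.center = t ∧ γ.carrier = arcSet t s r) := fun hij => by
    obtain ⟨h1, h2, h3⟩ := h.carrier_eq_arcSet_of_subset_region_none hst.symm hS' ht hs et' es'
      (neg_ne_zero.2 hb) hr' hij hsub hmax
    exact ⟨h2, Or.inr ⟨h1, h3⟩⟩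
  have hreg : ∀ p ∈ γ.carrier, p ∈ D.region i ∧ p ∈ D.region j := fun p hp =>
    ⟨connectedComponentIn_subset _ _ (hfr _ _ (hsub hp).1),
      connectedComponentIn_subset _ _ (hfr _ _ (hsub hp).2)⟩
  -- Faces are closed, so two faces of one region that share a frontier point coincide.
  have hij : i ≠ j := by
    rintro rfl
    obtain ⟨q, hq⟩ := γ.nonempty_carrier
    exact hne ((connectedComponentIn_eq (hfr _ _ (hsub hq).1)).trans
      (connectedComponentIn_eq (hfr _ _ (hsub hq).2)).symm)
  have hno := h.not_carrier_subset_region_inter hst hS hs ht es et hb γ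
  rcases i with _ | u <;> rcases j with _ | v
  · exact absurd rfl hij
  · rcases hS v with rfl | rfl
    exacts [hcs (Or.inr ⟨rfl, rfl⟩), hct (Or.inr ⟨rfl, rfl⟩)]
  · rcases hS u with rfl | rfl
    exacts [hcs (Or.inl ⟨rfl, rfl⟩), hct (Or.inl ⟨rfl, rfl⟩)]
  · rcases hS u with rfl | rfl <;> rcases hS v with rfl | rfl
    · exact absurd rfl hij
    · exact absurd hreg hno
    · exact absurd (fun p hp => (hreg p hp).symm) hno
    · exact absurd rfl hij

/-- Different edges are the arcs about different sites. A common point is at distance `r` from both,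
so it lies on the bisector and is an endpoint. -/
theorem not_hasTangentEdges (h : D.IsStableMatching A) (hst : s ≠ t)
    (hS : ∀ u, u = s ∨ u = t) (hs : D.IsMaxDist s r) (ht : D.IsMaxDist t r)
    (es : (s : Plane) = !₂[x - b, y]) (et : (t : Plane) = !₂[x + b, y]) (hb : b ≠ 0)
    (hr : |b| < r) : ¬ D.HasTangentEdges := by
  rintro ⟨γ, γ', hγ, hγ', hne, p, ⟨hp, hp'⟩, hend, hend'⟩
  have hcorner : ∀ {γ γ' : CircularArc}, γ.radius = r → γ.center = s →
      γ.carrier = arcSet s t r → γ'.carrier = arcSet t s r → p ∈ γ.carrier → p ∈ γ'.carrier →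
      γ.IsEndpoint p := by
    intro γ γ' hrad hc hcar hcar' hp hp'
    rw [es] at hc
    have hpx : p 0 = x := by
      have h1 : p ∈ arcSet s t r := hcar ▸ hp
      have h2 : p ∈ arcSet t s r := hcar' ▸ hp'
      have := h1.1.trans h2.1.symm
      rwa [es, et, dist_site_eq_iff hb] at this
    rw [es, et] at hcar
    exact γ.isEndpoint_of_carrier_eq_arcSet hb hr hc hrad hcar hp hpx
  obtain ⟨hrad, ⟨hc, hcar⟩ | ⟨hc, hcar⟩⟩ :=
    h.center_eq_and_carrier_eq_arcSet hst hS hs ht es et hb hr hγ <;>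
  obtain ⟨hrad', ⟨hc', hcar'⟩ | ⟨hc', hcar'⟩⟩ :=
    h.center_eq_and_carrier_eq_arcSet hst hS hs ht es et hb hr hγ'
  · exact hne (hcar.trans hcar'.symm)
  · exact hend (hcorner hrad hc hcar hcar' hp hp')
  · exact hend' (hcorner hrad' hc' hcar' hcar hp' hp)
  · exact hne (hcar.trans hcar'.symm)

end Diagram.IsStableMatching

/-! ### Two sites at a small algebraic distance -/

theorem hasAlgebraicCoordinates_twoSites {x y b : ℝ} (hx : IsAlgebraic ℚ x)
    (hy : IsAlgebraic ℚ y) (hb : IsAlgebraic ℚ b) :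
    ∀ s ∈ twoSites x y b, HasAlgebraicCoordinates s := by
  intro s hs
  simp only [twoSites, Finset.mem_insert, Finset.mem_singleton] at hs
  rcases hs with rfl | rfl <;> intro k <;> fin_cases k
  exacts [hx.sub hb, hy, hx.add hb, hy]

theorem exists_eq_twoSites {x y b : ℝ} (hb : b ≠ 0) :
    ∃ s t : twoSites x y b, (s : Plane) = !₂[x - b, y] ∧ (t : Plane) = !₂[x + b, y] ∧ s ≠ t ∧
      ∀ u, u = s ∨ u = t := by
  refine ⟨⟨!₂[x - b, y], by simp [twoSites]⟩, ⟨!₂[x + b, y], by simp [twoSites]⟩, rfl, rfl,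
    fun h => sites_ne hb (congrArg Subtype.val h), ?_⟩
  rintro ⟨u, hu⟩
  have hu' : u = !₂[x - b, y] ∨ u = !₂[x + b, y] := by simpa [twoSites] using hu
  exact hu'.imp Subtype.ext Subtype.ext

theorem halfDiskArea_eq_one_iff {b r ρ : ℝ} (hb : 0 < b) (hbr : b < r) (hr : halfDiskArea b r = 1)
    (hρ : b ≤ ρ) : halfDiskArea b ρ = 1 ↔ ρ = r := by
  refine ⟨fun h => ?_, fun h => h ▸ hr⟩
  rcases lt_trichotomy ρ r with hlt | heq | hgt
  · exact absurd (halfDiskArea_lt hb hρ hlt) (by rw [h, hr]; exact lt_irrefl _)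
  · exact heq
  · exact absurd (halfDiskArea_lt hb hbr.le hgt) (by rw [h, hr]; exact lt_irrefl _)

/-- In a stable diagram of two sites with unit appetites, the radius of the region of either site
is the one for which the half disk has unit area. -/
theorem isMaxDist_of_isStableMatching {x y b r : ℝ} (hb : 0 < b) (hb' : b < √(1 / Real.pi))
    (hbr : b < r) (hr : halfDiskArea b r = 1) {D : Diagram (twoSites x y b)}
    (hD : D.IsStableMatching fun _ => 1) (s : twoSites x y b) : D.IsMaxDist s r := by
  obtain ⟨s', t', es, et, hst, hS⟩ := exists_eq_twoSites (x := x) (y := y) hb.ne'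
  obtain ⟨R, hR0, hRs, hRt, hvol⟩ := hD.exists_common_maxDist hst hS rfl one_pos
  rw [es, et, ENNReal.ofReal_one] at hvol
  -- The area formula needs `b ≤ R`. A smaller radius is impossible, since even radius `b` encloses
  -- only `π b² < 1`.
  have hbR : b ≤ R := by
    by_contra! hlt
    have h1 := volume_halfDisk_lt (sites_ne (x := x) (y := y) hb.ne') hR0 hlt
    rw [hvol, volume_halfDisk_of_sites hb le_rfl, halfDiskArea_self hb] at h1
    have h2 := ENNReal.ofReal_lt_one.2 (pi_mul_sq_lt_one hb hb')
    exact lt_asymm h1 h2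
  rw [volume_halfDisk_of_sites hb hbR, ENNReal.ofReal_eq_one] at hvol
  obtain rfl := (halfDiskArea_eq_one_iff hb hbr hr hbR).1 hvol
  rcases hS s with rfl | rfl
  exacts [hRs, hRt]

theorem inGeneralPosition_twoSites {x y b : ℝ} (hb : 0 < b) (hb' : b < √(1 / Real.pi)) :
    InGeneralPosition (twoSites x y b) (fun _ => 1) := by
  intro D hD
  obtain ⟨r, hbr, hr⟩ := exists_halfDiskArea_eq_one hb hb'
  obtain ⟨s, t, es, et, hst, hS⟩ := exists_eq_twoSites (x := x) (y := y) hb.ne'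
  exact hD.not_hasTangentEdges hst hS (isMaxDist_of_isStableMatching hb hb' hbr hr hD s)
    (isMaxDist_of_isStableMatching hb hb' hbr hr hD t) es et hb.ne' (by rwa [abs_of_pos hb])

theorem exists_isStableMatching_twoSites {x y b : ℝ} (hb : 0 < b) (hb' : b < √(1 / Real.pi)) :
    ∃ D : Diagram (twoSites x y b), D.IsStableMatching fun _ => 1 := by
  obtain ⟨r, hbr, hr⟩ := exists_halfDiskArea_eq_one hb hb'
  obtain ⟨s, t, es, et, hst, hS⟩ := exists_eq_twoSites (x := x) (y := y) hb.ne'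
  refine ⟨nearestDiagram _ r, isStableMatching_nearestDiagram hst hS ?_ ?_⟩
  · refine lt_of_pow_lt_pow_left₀ 2 (by linarith) ?_
    rw [es, et, dist_other_site_sq]
    simp only [Matrix.cons_val_zero, Matrix.cons_val_one]
    nlinarith
  · rw [es, et, volume_halfDisk_of_sites hb hbr.le, hr, ENNReal.ofReal_one]

theorem half_lt_sqrt_one_div_pi : (1 / 2 : ℝ) < √(1 / Real.pi) := by
  rw [Real.lt_sqrt (by norm_num), lt_div_iff₀ Real.pi_pos]
  linarith [Real.pi_lt_four]

theorem twoSites_injective_left (y : ℝ) {b : ℝ} (hb : 0 < b) :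
    Function.Injective fun x => twoSites x y b := by
  have key : ∀ {x x' : ℝ}, twoSites x y b = twoSites x' y b → x' ≤ x := by
    intro x x' h
    have : (!₂[x - b, y] : Plane) ∈ twoSites x' y b := by
      rw [← h]
      simp [twoSites]
    simp only [twoSites, Finset.mem_insert, Finset.mem_singleton] at this
    rcases this with h | h <;>
    · have := congrArg (fun p : Plane => p 0) h
      simp at this
      linarith
  exact fun x x' h => le_antisymm (key h.symm) (key h)

theorem mainTheorem5 :
    {S : Finset Plane |
      (∀ s ∈ S, HasAlgebraicCoordinates s) ∧
      InGeneralPosition S (fun _ => 1) ∧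
      (∃ D : Diagram S, D.IsStableMatching fun _ => 1) ∧
      ∀ D : Diagram S, (D.IsStableMatching fun _ => 1) →
        ∃ s r, D.IsBoundingRadius s r ∧
          ¬ AlgebraicallyComputable S (fun _ => 1) r}.Infinite ∧
    ∀ x y b : ℝ, IsAlgebraic ℚ x → IsAlgebraic ℚ y → IsAlgebraic ℚ b →
      0 < b → b < √(1 / Real.pi) →
      (∀ s ∈ twoSites x y b, HasAlgebraicCoordinates s) ∧
      InGeneralPosition (twoSites x y b) (fun _ => 1) ∧
      (∃ D : Diagram (twoSites x y b), D.IsStableMatching fun _ => 1) ∧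
      ∃ r : ℝ, b < r ∧
        (∀ D : Diagram (twoSites x y b), (D.IsStableMatching fun _ => 1) →
          ∀ s, D.IsBoundingRadius s r) ∧
        (∀ ρ : ℝ, b ≤ ρ →
          (ρ ^ 2 * (Real.pi - Real.arccos (b / ρ)) + b * √(ρ ^ 2 - b ^ 2) = 1 ↔ ρ = r)) ∧
        ¬ AlgebraicallyComputable (twoSites x y b) (fun _ => 1) r := by

  have main : ∀ x y b : ℝ, IsAlgebraic ℚ x → IsAlgebraic ℚ y → IsAlgebraic ℚ b →
      0 < b → b < √(1 / Real.pi) →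
      (∀ s ∈ twoSites x y b, HasAlgebraicCoordinates s) ∧
      InGeneralPosition (twoSites x y b) (fun _ => 1) ∧
      (∃ D : Diagram (twoSites x y b), D.IsStableMatching fun _ => 1) ∧
      ∃ r : ℝ, b < r ∧
        (∀ D : Diagram (twoSites x y b), (D.IsStableMatching fun _ => 1) →
          ∀ s, D.IsBoundingRadius s r) ∧
        (∀ ρ : ℝ, b ≤ ρ →
          (ρ ^ 2 * (Real.pi - Real.arccos (b / ρ)) + b * √(ρ ^ 2 - b ^ 2) = 1 ↔ ρ = r)) ∧
        ¬ AlgebraicallyComputable (twoSites x y b) (fun _ => 1) r := by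
    intro x y b hx hy hb hb0 hb'
    have halg := hasAlgebraicCoordinates_twoSites hx hy hb
    obtain ⟨r, hbr, hr⟩ := exists_halfDiskArea_eq_one hb0 hb'
    exact ⟨halg, inGeneralPosition_twoSites hb0 hb', exists_isStableMatching_twoSites hb0 hb',
      r, hbr,
      fun D hD s => (isMaxDist_of_isStableMatching hb0 hb' hbr hr hD s).isBoundingRadius,
      fun ρ hρ => halfDiskArea_eq_one_iff hb0 hbr hr hρ,
      fun hcomp => not_isAlgebraic_radius hb hb0 hbr hr
        (hcomp.isAlgebraic halg fun _ => isAlgebraic_one)⟩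
  refine ⟨?_, main⟩
  have hhalf : IsAlgebraic ℚ (1 / 2 : ℝ) := by
    simpa using isAlgebraic_algebraMap (A := ℝ) (1 / 2 : ℚ)
  refine (Set.infinite_range_of_injective ((twoSites_injective_left 0
    (one_half_pos (α := ℝ))).comp Nat.cast_injective)).mono ?_
  rintro _ ⟨n, rfl⟩
  obtain ⟨h1, h2, h3, r, -, h4, -, h5⟩ := main n 0 (1 / 2) (isAlgebraic_natCast n) isAlgebraic_zero
    hhalf one_half_pos half_lt_sqrt_one_div_pi
  obtain ⟨s, -⟩ := exists_eq_twoSites (x := n) (y := 0) (one_half_pos (α := ℝ)).ne'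
  exact ⟨h1, h2, h3, fun D hD => ⟨s, r, h4 D hD s, h5⟩⟩
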